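/- Let $\triangle\subset\mathbb R^n$ be a reflexive lattice polytope, $\triangle^\vee=\{u:\langle x,u\rangle\ge -1\ \forall x\in\triangle\}$ its dual, and $X=\mathbb P_\triangle$ the corresponding Gorenstein Fano toric variety. Assume that $\triangle$ and $\triangle^\vee$ admit regular projective triangulations, and fix such triangulations $\mathcal T$ of $\triangle$ and $\mathcal T^\vee$ of $\triangle^\vee$: the vertices are lattice points, the origin is a vertex of every maximal simplex, all maximal simplices are unimodular, and there is a strictly convex function that is affine on each simplex. Let $\Sigma_{\triangle,\mathcal T}$ and $\Sigma_{\triangle^\vee,\mathcal T^\vee}$ be the fans of cones over the simplices of $\mathcal T$ and $\mathcal T^\vee$, and let $\widetilde{X^\vee}$ be the smooth projective toric variety of $\Sigma_{\triangle,\mathcal T}$. Let $\mathcal A=\triangle\cap\mathbb Z^n=\{v_0=0,v_1,\dots,v_p\}$ and $L=\{\ell\in\mathbb Z^{p+1}:\sum_i\ell_iv_i=0,\ \sum_i\ell_i=0\}$. Let $M$ be the set of $\ell\in L$ with $\sum_i\omega_i\ell_i\ge0$ for all weights $\omega\in\mathbb R^{p+1}$ for which the $\mathcal T$-piecewise linear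 function with values $\omega_i$ at $v_i$ is convex (the integral points of the Mori cone of $\widetilde{X^\vee}$). The cohomology ring $H^\bullet(\widetilde{X^\vee},\mathbb C)$ is the quotient of $\mathbb C[D_0,\dots,D_p]$ by the relations $\sum_{i=0}^pD_i=0$, $\sum_{i=1}^p v_i^jD_i=0$ $(1\le j\le n)$, and $D_{i_1}\cdots D_{i_k}=0$ whenever $\{i_1,\dots,i_k\}\subset\{1,\dots,p\}$ is a nonempty set such that $v_{i_1},\dots,v_{i_k}$ do not generate a cone of $\Sigma_{\triangle,\mathcal T}$. Put $$B_{X,\mathcal T}(a)=\frac1{a_0}\Big(\sum_{\ell\in M}O_\ell\,\prod_{i=0}^pa_i^{\ell_i}\Big)\exp\Big(\sum_{i=0}^p(\log a_i)D_i\Big),$$ $$O_\ell=\frac{\prod_{i\ge1,\,\ell_i<0}D_i(D_i-1)\cdots(D_i+\ell_i+1)}{\prod_{i\ge1,\,\ell_i\ge0}(D_i+1)\cdots(D_i+\ell_i)}\,(D_0-1)(D_0-2)\cdots(D_0+\ell_0).$$ Let $R(\Sigma_{\triangle^\vee,\mathcal T^\vee})$ be the set of $v\in\mathbb Z^n$ for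 which there is a primitive ray generator $u\in\Sigma_{\triangle^\vee,\mathcal T^\vee}(1)$ with $\langle v,u\rangle=-1$ and $\langle v,u'\rangle\ge0$ for all $u'\in\Sigma_{\triangle^\vee,\mathcal T^\vee}(1)$, $u'\ne u$. For such $v$, with corresponding $u$, put $$\pounds_v=\sum_{v'\in\mathcal A,\ \langle v',u\rangle\ne-1}(\langle v',u\rangle+1)\,a_{v'}\frac{\partial}{\partial a_{v'+v}}.$$ **Theorem.** There is $\varepsilon\in(0,1)$ such that the set $\{a\in(\mathbb C^*)^{p+1}:|a^\ell|<\varepsilon\text{ for all }0\ne\ell\in M\}$ (a neighbourhood of the large complex structure limit) is open and nonempty, the sum over $M$ in $B_{X,\mathcal T}(a)$ converges absolutely at each of its points, and the following holds on every open subset $U$ of it on which continuous branches of all $\log a_i$ are given. For every linear form $\alpha$ on $H^\bullet(\widetilde{X^\vee},\mathbb C)$ the coefficient function $f(a)=\langle B_{X,\mathcal T}(a)\cdot(-D_0),\alpha\rangle$ is analytic on $U$ and satisfies $$\pounds_v f=0\qquad\text{for all }v\in R(\Sigma_{\triangle^\vee,\mathcal T^\vee}),$$ that is, $\pounds_v\big(B_{X,\mathcal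 T}(a)\cdot(-D_0)\big)=0$. Moreover $f$ solves the extended GKZ-system on $U$: in addition to $\pounds_vf=0$ for all roots $v$, $$\Big(\prod_{\ell_i>0}\Big(\tfrac{\partial}{\partial a_i}\Big)^{\ell_i}-\prod_{\ell_j<0}\Big(\tfrac{\partial}{\partial a_j}\Big)^{-\ell_j}\Big)f=0\ (\ell\in L),\qquad \sum_{i=1}^pv_i^ja_i\frac{\partial f}{\partial a_i}=0\ (1\le j\le n),\qquad \Big(\sum_{i=0}^pa_i\frac{\partial}{\partial a_i}+1\Big)f=0.$$ -/

import Mathlib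

open Finset Set

noncomputable section

namespace ToricGKZ

/-! ### Reflexive polytopes and regular projective triangulations -/

/-- The inclusion of the lattice `ℤⁿ` into `ℝⁿ`. -/
def latt {n : ℕ} (v : Fin n → ℤ) : Fin n → ℝ := fun i => (v i : ℝ)

/-- `Q` is a lattice polytope: the convex hull of finitely many points of `ℤⁿ`. -/
def IsLatticePolytope {n : ℕ} (Q : Set (Fin n → ℝ)) : Prop :=
  ∃ V : Finset (Fin n → ℤ), Q = convexHull ℝ (latt '' (V : Set (Fin n → ℤ)))

/-- The dual (polar) `Q^∨ = {u | ⟨x, u⟩ ≥ -1 for all x ∈ Q}`. -/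
def polarDual {n : ℕ} (Q : Set (Fin n → ℝ)) : Set (Fin n → ℝ) :=
  {u | ∀ x ∈ Q, -1 ≤ x ⬝ᵥ u}

/-- A reflexive polytope in `ℝⁿ`: a lattice polytope with the origin in its interior whose dual is
again a lattice polytope. -/
structure ReflexivePolytope (n : ℕ) where
  carrier : Set (Fin n → ℝ)
  isLatticePolytope : IsLatticePolytope carrier
  zero_mem_interior : (0 : Fin n → ℝ) ∈ interior carrier
  dual_isLatticePolytope : IsLatticePolytope (polarDual carrier)

/-- A regular projective triangulation of `Q`: a triangulation with lattice points as vertices,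
such that the origin is a vertex of every maximal simplex, all maximal simplices are unimodular,
and there is a strictly convex piecewise linear function. -/
structure RegularProjectiveTriangulation {n : ℕ} (Q : Set (Fin n → ℝ)) where
  complex : Geometry.SimplicialComplex ℝ (Fin n → ℝ)
  space_eq : complex.space = Q
  vertices_integral : ∀ x ∈ complex.vertices, ∃ v : Fin n → ℤ, latt v = x
  zero_mem_facets : ∀ s ∈ complex.facets, (0 : Fin n → ℝ) ∈ s
  /-- As `0` is a vertex of the simplex `s`, its normalized volume is `1` exactly when its vertices
  generate the lattice `ℤⁿ`. -/
  unimodular : ∀ s ∈ complex.facets, ∀ v : Fin n → ℤ,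
    latt v ∈ Submodule.span ℤ (s : Set (Fin n → ℝ))
  /-- On each maximal simplex the heights `ω` agree with an affine function, which lies strictly
  below `ω` at all lattice points outside that simplex. -/
  projective : ∃ ω : (Fin n → ℤ) → ℝ, ∀ s ∈ complex.facets, ∃ (m : Fin n → ℝ) (c : ℝ),
    (∀ v, latt v ∈ s → m ⬝ᵥ latt v + c = ω v) ∧
    ∀ v, latt v ∈ Q → latt v ∉ s → m ⬝ᵥ latt v + c < ω v

/-- The rays (primitive generators) `Σ(1)` of the fan of cones over the simplices of a regular
projective triangulation: its nonzero vertices. -/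
def RegularProjectiveTriangulation.rays {n : ℕ} {Q : Set (Fin n → ℝ)}
    (T : RegularProjectiveTriangulation Q) : Set (Fin n → ℤ) :=
  {u | u ≠ 0 ∧ latt u ∈ T.complex.vertices}

/-- `v` belongs to the root system `R(Σ)` of the fan of `T`, with corresponding ray `u`. -/
def RegularProjectiveTriangulation.IsRootWithRay {n : ℕ} {Q : Set (Fin n → ℝ)}
    (T : RegularProjectiveTriangulation Q) (v u : Fin n → ℤ) : Prop :=
  u ∈ T.rays ∧ v ⬝ᵥ u = -1 ∧ ∀ u' ∈ T.rays, u' ≠ u → 0 ≤ v ⬝ᵥ u'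

/-! ### Lattice points, relations, Mori cone -/

/-- The set `𝒜 = △ ∩ ℤⁿ` of lattice points of `△`. -/
abbrev ReflexivePolytope.Point {n : ℕ} (P : ReflexivePolytope n) : Type :=
  {v : Fin n → ℤ // latt v ∈ P.carrier}

theorem ReflexivePolytope.finite_points {n : ℕ} (P : ReflexivePolytope n) :
    Set.Finite {v : Fin n → ℤ | latt v ∈ P.carrier} := by
  obtain ⟨V, hV⟩ := P.isLatticePolytope
  have hb : Bornology.IsBounded P.carrier := by
    rw [hV]
    exact ((V.finite_toSet.image latt).isCompact_convexHull (𝕜 := ℝ)).isBounded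
  obtain ⟨R, hR⟩ := hb.exists_norm_le
  refine (Set.finite_Icc (fun _ : Fin n => -⌈R⌉) (fun _ => ⌈R⌉)).subset ?_
  intro v hv
  have h : ∀ i, |(v i : ℝ)| ≤ (⌈R⌉ : ℝ) := fun i =>
    ((norm_le_pi_norm (latt v) i).trans (hR _ hv)).trans (Int.le_ceil R)
  constructor
  · intro i
    have := (abs_le.1 (h i)).1
    exact_mod_cast this
  · intro i
    have := (abs_le.1 (h i)).2
    exact_mod_cast this

instance {n : ℕ} (P : ReflexivePolytope n) : Fintype P.Point := P.finite_points.fintype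

instance {n : ℕ} (P : ReflexivePolytope n) : DecidableEq P.Point := Classical.decEq _

/-- The lattice point `v₀ = 0` of `△`. -/
def ReflexivePolytope.origin {n : ℕ} (P : ReflexivePolytope n) : P.Point :=
  ⟨0, by
    have h : latt (0 : Fin n → ℤ) = 0 := by ext; simp [latt]
    rw [h]
    exact interior_subset P.zero_mem_interior⟩

/-- The lattice `L` of affine relations among the lattice points of `△`. -/
def ReflexivePolytope.relations {n : ℕ} (P : ReflexivePolytope n) : Set (P.Point → ℤ) :=
  {ℓ | ∑ v, ℓ v • v.1 = 0 ∧ ∑ v, ℓ v = 0}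

variable {n : ℕ} {P : ReflexivePolytope n}

/-- The preimage in `ℝ^𝒜` of the (closed) Kähler cone: weights `ω` for which the `T`-piecewise
linear function with values `ω v` at the lattice points `v` is convex, i.e. on every maximal
simplex it extends to an affine function lying below `ω` everywhere. -/
def kaehlerCone (T : RegularProjectiveTriangulation P.carrier) : Set (P.Point → ℝ) :=
  {ω | ∀ s ∈ T.complex.facets, ∃ (m : Fin n → ℝ) (c : ℝ),
    (∀ v : P.Point, latt v.1 ∈ s → m ⬝ᵥ latt v.1 + c = ω v) ∧
    ∀ v : P.Point, m ⬝ᵥ latt v.1 + c ≤ ω v}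

/-- The set `M` of integral points of the Mori cone, the dual of the Kähler cone. -/
def moriPoints (T : RegularProjectiveTriangulation P.carrier) : Set (P.Point → ℤ) :=
  {ℓ | ℓ ∈ P.relations ∧ ∀ ω ∈ kaehlerCone T, 0 ≤ ∑ v, ω v * (ℓ v : ℝ)}

/-! ### The cohomology ring -/

/-- The ideal generated by the linear equivalence relations and by the Stanley–Reisner ideal.
A nonempty set of nonzero lattice points of `△` generates a cone of the fan exactly when it is a
simplex of `T`. -/
def cohomologyIdeal (T : RegularProjectiveTriangulation P.carrier) :
    Ideal (MvPolynomial P.Point ℂ) :=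
  Ideal.span
    ({∑ v : P.Point, MvPolynomial.X v} ∪
      {q | ∃ j : Fin n, q = ∑ v : P.Point, MvPolynomial.C ((v.1 j : ℤ) : ℂ) * MvPolynomial.X v} ∪
      {q | ∃ S : Finset P.Point, S.Nonempty ∧ P.origin ∉ S ∧
        (∀ s ∈ T.complex.faces,
          (s : Set (Fin n → ℝ)) ≠ (fun v : P.Point => latt v.1) '' (S : Set P.Point)) ∧
        q = ∏ v ∈ S, MvPolynomial.X v})

/-- The cohomology ring `H^•(X̃^∨_T, ℂ)` of the smooth projective toric variety of the fan of
cones over the simplices of `T`, in its standard presentation. -/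
def CohomologyRing (T : RegularProjectiveTriangulation P.carrier) : Type :=
  MvPolynomial P.Point ℂ ⧸ cohomologyIdeal T

instance (T : RegularProjectiveTriangulation P.carrier) : CommRing (CohomologyRing T) :=
  inferInstanceAs (CommRing (MvPolynomial P.Point ℂ ⧸ cohomologyIdeal T))

instance (T : RegularProjectiveTriangulation P.carrier) : Algebra ℂ (CohomologyRing T) :=
  inferInstanceAs (Algebra ℂ (MvPolynomial P.Point ℂ ⧸ cohomologyIdeal T))

instance (T : RegularProjectiveTriangulation P.carrier) : Algebra ℚ (CohomologyRing T) :=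
  Algebra.compHom (CohomologyRing T) (algebraMap ℚ ℂ)

/-- The ring is a finite-dimensional complex vector space; it carries the usual topology of such a
space. -/
instance (T : RegularProjectiveTriangulation P.carrier) : TopologicalSpace (CohomologyRing T) :=
  moduleTopology ℂ (CohomologyRing T)

/-- The divisor class `D_v`, `v ∈ 𝒜` (so `D₀` is the canonical class). -/
def divisor (T : RegularProjectiveTriangulation P.carrier) (v : P.Point) : CohomologyRing T :=
  Ideal.Quotient.mk (cohomologyIdeal T) (MvPolynomial.X v)

/-! ### The series `B` -/

/-- The coefficient `O_ℓ`. The products over `range (-ℓ v).toNat` and `range (ℓ v).toNat` are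
empty unless `ℓ v < 0`, respectively `ℓ v > 0`. The divisor classes are nilpotent, so the
denominator is a unit of the ring. -/
def coeffO (T : RegularProjectiveTriangulation P.carrier) (ℓ : P.Point → ℤ) : CohomologyRing T :=
  (∏ v ∈ univ.erase P.origin, ∏ k ∈ range (-ℓ v).toNat, (divisor T v - (k : CohomologyRing T))) *
  Ring.inverse (∏ v ∈ univ.erase P.origin,
    ∏ k ∈ range (ℓ v).toNat, (divisor T v + ((k + 1 : ℕ) : CohomologyRing T))) *
  ∏ k ∈ range (-ℓ P.origin).toNat, (divisor T P.origin - ((k + 1 : ℕ) : CohomologyRing T))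

/-- The monomial `a^ℓ = ∏ a_v^{ℓ_v}`. -/
def monomial (a : P.Point → ℂ) (ℓ : P.Point → ℤ) : ℂ := ∏ v, a v ^ ℓ v

/-- The series `B_{X,T}(a)`, where `lg a v` is the value of `log a_v` for the chosen branches of
the logarithms. -/
def seriesB (T : RegularProjectiveTriangulation P.carrier)
    (lg : (P.Point → ℂ) → (P.Point → ℂ)) (a : P.Point → ℂ) : CohomologyRing T :=
  (a P.origin)⁻¹ • ((∑' ℓ : moriPoints T, monomial a ℓ.1 • coeffO T ℓ.1) *
    IsNilpotent.exp (∑ v, lg a v • divisor T v))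

/-- A neighbourhood of the large complex structure limit in the torus `(ℂ^*)^𝒜`: all monomials
`a^ℓ` with `0 ≠ ℓ ∈ M` are smaller than `ε`. -/
def nearLCSL (T : RegularProjectiveTriangulation P.carrier) (ε : ℝ) : Set (P.Point → ℂ) :=
  {a | (∀ v, a v ≠ 0) ∧ ∀ ℓ ∈ moriPoints T, ℓ ≠ 0 → ‖monomial a ℓ‖ < ε}

/-! ### The extended GKZ-system -/

/-- The partial derivative `∂/∂a_v`. -/
def partialD (v : P.Point) (f : (P.Point → ℂ) → ℂ) : (P.Point → ℂ) → ℂ :=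
  fun a => lineDeriv ℂ f a (Pi.single v 1)

/-- The higher partial derivative `∏_v (∂/∂a_v)^{m_v}`. (The order in which the derivatives are
taken plays no role for analytic functions.) -/
def mixedD (m : P.Point → ℕ) (f : (P.Point → ℂ) → ℂ) : (P.Point → ℂ) → ℂ :=
  (univ : Finset P.Point).toList.foldr (fun v g => (partialD v)^[m v] g) f

/-- The analytic function `f` solves the GKZ-system on `U`. -/
structure IsGKZSolution (U : Set (P.Point → ℂ)) (f : (P.Point → ℂ) → ℂ) : Prop where
  analytic : AnalyticOnNhd ℂ f U
  box : ∀ ℓ ∈ P.relations, ∀ a ∈ U,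
    mixedD (fun v => (ℓ v).toNat) f a - mixedD (fun v => (-ℓ v).toNat) f a = 0
  torus : ∀ j : Fin n, ∀ a ∈ U, ∑ v : P.Point, ((v.1 j : ℤ) : ℂ) * a v * partialD v f a = 0
  euler : ∀ a ∈ U, ∑ v, a v * partialD v f a + f a = 0

/-- The indices occurring in the root operator are well defined: `v' + v` lies in `△`. -/
theorem add_mem_of_isRootWithRay {T' : RegularProjectiveTriangulation (polarDual P.carrier)}
    {v u : Fin n → ℤ} (h : T'.IsRootWithRay v u) (v' : P.Point) (hv' : v'.1 ⬝ᵥ u ≠ -1) :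
    latt (v'.1 + v) ∈ P.carrier := by
  have hdot : ∀ x y : Fin n → ℤ, latt x ⬝ᵥ latt y = ((x ⬝ᵥ y : ℤ) : ℝ) := by
    intro x y
    simp [latt, dotProduct]
  have key : ∀ y ∈ polarDual P.carrier, -1 ≤ latt (v'.1 + v) ⬝ᵥ y := by
    intro y hy
    have hy' := hy
    rw [← T'.space_eq, Geometry.SimplicialComplex.mem_space_iff] at hy'
    obtain ⟨s, hs, hys⟩ := hy'
    have hconv : Convex ℝ {y : Fin n → ℝ | -1 ≤ latt (v'.1 + v) ⬝ᵥ y} := by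
      intro a ha b hb p q hp hq hpq
      simp only [Set.mem_ofPred_eq, dotProduct_add, dotProduct_smul, smul_eq_mul] at *
      nlinarith
    refine convexHull_min ?_ hconv hys
    intro z hz
    have hzP : z ∈ polarDual P.carrier := by
      rw [← T'.space_eq]
      exact T'.complex.subset_space hs hz
    have hzv : z ∈ T'.complex.vertices :=
      T'.complex.down_closed hs (by simpa using hz) (by simp)
    obtain ⟨w, rfl⟩ := T'.vertices_integral z hzv
    have h1 : -1 ≤ v'.1 ⬝ᵥ w := by
      have := hzP _ v'.2
      rw [hdot] at this
      exact_mod_cast this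
    simp only [Set.mem_ofPred_eq]
    rw [hdot]
    have h2 : -1 ≤ (v'.1 + v) ⬝ᵥ w := by
      rw [add_dotProduct]
      by_cases hw0 : w = 0
      · subst hw0
        simp
      by_cases hwu : w = u
      · subst hwu
        have := h.2.1
        omega
      · have := h.2.2 w ⟨hw0, hzv⟩ hwu
        omega
    exact_mod_cast h2
  obtain ⟨V, hV⟩ := P.isLatticePolytope
  have hc : Convex ℝ P.carrier := by
    rw [hV]
    exact convex_convexHull ℝ _
  have hcl : IsClosed P.carrier := by
    rw [hV]
    exact ((V.finite_toSet.image latt).isCompact_convexHull (𝕜 := ℝ)).isClosed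
  by_contra hx
  obtain ⟨f, r, hfx, hfP⟩ := geometric_hahn_banach_point_closed hc hcl hx
  have hr : r < 0 := by
    have := hfP 0 (interior_subset P.zero_mem_interior)
    simpa using this
  have hf : ∀ x : Fin n → ℝ, f x = x ⬝ᵥ (fun i => f (Pi.single i 1)) := by
    intro x
    conv_lhs => rw [pi_eq_sum_univ' x]
    simp [dotProduct, map_sum]
  have hy := key ((-r)⁻¹ • (fun i => f (Pi.single i 1))) (by
    intro x hxP
    have := hfP x hxP
    rw [dotProduct_smul, ← hf, smul_eq_mul, ← div_eq_inv_mul, le_div_iff₀ (by linarith)]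
    linarith)
  rw [dotProduct_smul, ← hf, smul_eq_mul, ← div_eq_inv_mul, le_div_iff₀ (by linarith)] at hy
  linarith

open Classical in
/-- The operator `£_v`, for a root `v` with corresponding ray `u`: the sum of
`(⟨v', u⟩ + 1) a_{v'} ∂/∂a_{v' + v}` over the lattice points `v'` of `△` not on the facet
`⟨v', u⟩ = -1`. For these `v'` there is exactly one lattice point `w` of `△` with `w = v' + v`,
see `add_mem_of_isRootWithRay`. -/
def rootOperator (v u : Fin n → ℤ) (f : (P.Point → ℂ) → ℂ) : (P.Point → ℂ) → ℂ :=
  fun a => ∑ v' : P.Point, ∑ w : P.Point,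
    if v'.1 ⬝ᵥ u ≠ -1 ∧ w.1 = v'.1 + v then
      ((v'.1 ⬝ᵥ u + 1 : ℤ) : ℂ) * a v' * partialD w f a
    else 0

/-- `f` solves the extended GKZ-system on `U`; the roots are those of the fan over `T'`, a
triangulation of the dual polytope. -/
structure IsExtendedGKZSolution (T' : RegularProjectiveTriangulation (polarDual P.carrier))
    (U : Set (P.Point → ℂ)) (f : (P.Point → ℂ) → ℂ) : Prop extends IsGKZSolution U f where
  root : ∀ v u, T'.IsRootWithRay v u → ∀ a ∈ U, rootOperator v u f a = 0

end ToricGKZ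

end

/-!
For a degree `d = (w, k)`, consider the gamma series with values in the cohomology ring

  `Φ_d = ∑_p a ^ p · ∏_v Γ(D_v + 1) / Γ(D_v + p_v + 1) · exp (∑_v log a_v · D_v)`,

the sum being over the integral exponents `p` with `∑ p_v v = w` and `∑ p_v = k`. The functional
equation of `Γ` gives `∂Φ_d / ∂a_v = Φ_{d - (v, 1)}`, the linear relations between the `D_v` make
`Φ_d` quasihomogeneous of degree `d`, and `-D_0 · B = -Φ_{(0, -1)}`. The box, torus and Euler
equations follow at once. The derivatives in `£_v Φ_{(0, -1)}` are those of `Φ_{(-v, -1)}`, and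
`£_v` acts as the Euler operator of the weight `⟨·, u⟩ + 1` on `Φ_{(-v, -1)}`, where its eigenvalue
is `-⟨v, u⟩ - 1 = 0`.

For convergence, the Stanley–Reisner relations confine the support of `Φ_d`, for the degrees `d`
that occur, to a translate of `M`. By Gordan's lemma `M` is finitely generated, and it lies in a
half space because `T` is projective. The coefficients grow at most geometrically in `∑ |p_v|`, as
`∑ p_v` is fixed, so writing exponents as words in the generators bounds `Φ_d` by a power series in
finitely many small monomials.
-/

noncomputable section
namespace ToricGKZ

open Filter Topology

/-! ### Gamma factors -/

section GammaFactor

variable {R : Type*} [CommRing R]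

/-- The formal quotient `Γ(x + 1) / Γ(x + k + 1)`, a rational function of `x`, evaluated in a
commutative ring. For `k > 0` this has the intended meaning where `x + 1, …, x + k` are units. -/
def gammaFactor (x : R) (k : ℤ) : R :=
  (∏ j ∈ range (-k).toNat, (x - (j : R))) *
    Ring.inverse (∏ j ∈ range k.toNat, (x + ((j + 1 : ℕ) : R)))

theorem isUnit_add_natCast_succ (k : Type*) [Field k] [CharZero k] [Algebra k R] {x : R}
    (hx : IsNilpotent x) (j : ℕ) : IsUnit (x + ((j + 1 : ℕ) : R)) := by
  have h : IsUnit ((j + 1 : ℕ) : R) := by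
    simpa using (Nat.cast_ne_zero (R := k).2 j.succ_ne_zero).isUnit.map (algebraMap k R)
  rw [add_comm]
  exact hx.isUnit_add_left_of_commute h (Commute.all _ _)

theorem add_mul_gammaFactor (k : Type*) [Field k] [CharZero k] [Algebra k R] {x : R}
    (hx : IsNilpotent x) (m : ℤ) :
    (x + (m : R)) * gammaFactor x m = gammaFactor x (m - 1) := by
  rcases le_or_gt m 0 with hm | hm
  · have h1 : (-(m - 1)).toNat = (-m).toNat + 1 := by omega
    have h2 : ((-m).toNat : R) = -(m : R) := by
      rw [← Int.cast_natCast, Int.toNat_of_nonneg (by omega), Int.cast_neg]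
    rw [gammaFactor, gammaFactor, h1, Int.toNat_of_nonpos hm,
      Int.toNat_of_nonpos (by omega : m - 1 ≤ 0), Finset.prod_range_succ, h2]
    ring
  · have h1 : m.toNat = (m - 1).toNat + 1 := by omega
    have h2 : (((m - 1).toNat + 1 : ℕ) : R) = (m : R) := by
      rw [← h1, ← Int.cast_natCast, Int.toNat_of_nonneg hm.le]
    have hunit := isUnit_add_natCast_succ k hx (m - 1).toNat
    rw [gammaFactor, gammaFactor, h1, Int.toNat_of_nonpos (by omega : -m ≤ 0),
      Int.toNat_of_nonpos (by omega : -(m - 1) ≤ 0), Finset.prod_range_succ,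
      Ring.mul_inverse_rev, ← h2, mul_left_comm, ← mul_assoc (x + _),
      Ring.mul_inverse_cancel _ hunit, one_mul]

theorem gammaFactor_of_nonpos (x : R) {k : ℤ} (hk : k ≤ 0) :
    gammaFactor x k = ∏ j ∈ range (-k).toNat, (x - (j : R)) := by
  rw [gammaFactor, Int.toNat_of_nonpos hk, Finset.range_zero, Finset.prod_empty,
    Ring.inverse_one, mul_one]

theorem dvd_gammaFactor_of_neg (x : R) {k : ℤ} (hk : k < 0) : x ∣ gammaFactor x k := by
  rw [gammaFactor_of_nonpos x hk.le]
  simpa using Finset.dvd_prod_of_mem (fun j : ℕ => x - (j : R))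
    (Finset.mem_range.2 (by omega : 0 < (-k).toNat))

theorem gammaFactor_sub_one_mul (x : R) {k : ℤ} (hk : k ≤ 0) :
    gammaFactor (x - 1) k * x = gammaFactor x (k - 1) := by
  have hk' : (-(k - 1)).toNat = (-k).toNat + 1 := by omega
  rw [gammaFactor_of_nonpos _ hk, gammaFactor_of_nonpos _ (by omega), hk',
    Finset.prod_range_succ']
  simp [sub_sub, add_comm]

theorem map_ringInverse_of_equiv {S : Type*} [CommRing S] (φ : R ≃+* S) (x : R) :
    φ (Ring.inverse x) = Ring.inverse (φ x) := by
  by_cases hx : IsUnit x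
  · refine (hx.map φ).mul_left_cancel ?_
    rw [← map_mul, Ring.mul_inverse_cancel x hx, map_one, Ring.mul_inverse_cancel _ (hx.map φ)]
  · rw [Ring.inverse_non_unit _ hx, Ring.inverse_non_unit _ (by simpa using hx), map_zero]

theorem map_gammaFactor {S : Type*} [CommRing S] (φ : R ≃+* S) (x : R) (k : ℤ) :
    φ (gammaFactor x k) = gammaFactor (φ x) k := by
  simp [gammaFactor, map_ringInverse_of_equiv]

variable {ι : Type*} [Fintype ι]

/-- The coefficient `∏ i, Γ(D i + 1) / Γ(D i + p i + 1)` of a Gamma series. -/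
def gammaCoeff (D : ι → R) (p : ι → ℤ) : R := ∏ i, gammaFactor (D i) (p i)

theorem add_mul_gammaCoeff [DecidableEq ι] (k : Type*) [Field k] [CharZero k] [Algebra k R]
    {D : ι → R} (hD : ∀ i, IsNilpotent (D i)) (p : ι → ℤ) (i : ι) :
    (D i + (p i : R)) * gammaCoeff D p = gammaCoeff D (p - Pi.single i 1) := by
  have hne : ∀ j ∈ univ.erase i, gammaFactor (D j) ((p - Pi.single i 1 : ι → ℤ) j) =
      gammaFactor (D j) (p j) := fun j hj => by simp [Finset.ne_of_mem_erase hj]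
  rw [gammaCoeff, gammaCoeff, ← Finset.mul_prod_erase _ _ (Finset.mem_univ i),
    ← Finset.mul_prod_erase _ _ (Finset.mem_univ i), Finset.prod_congr rfl hne, ← mul_assoc,
    add_mul_gammaFactor k (hD i), Pi.sub_apply, Pi.single_eq_same]

theorem prod_dvd_gammaCoeff (D : ι → R) (p : ι → ℤ) {S : Finset ι} (hS : ∀ i ∈ S, p i < 0) :
    ∏ i ∈ S, D i ∣ gammaCoeff D p :=
  (Finset.prod_dvd_prod_of_dvd _ (fun i => gammaFactor (D i) (p i)) fun i hi =>
    dvd_gammaFactor_of_neg (D i) (hS i hi)).trans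
      (Finset.prod_dvd_prod_of_subset _ _ _ (Finset.subset_univ S))

theorem gammaCoeff_sub_single_mul [DecidableEq ι] (D : ι → R) {p : ι → ℤ} {i : ι}
    (hp : p i ≤ 0) :
    gammaCoeff (D - Pi.single i 1) p * D i = gammaCoeff D (p - Pi.single i 1) := by
  have hne : ∀ j ∈ univ.erase i, gammaFactor ((D - Pi.single i 1 : ι → R) j) (p j) =
      gammaFactor (D j) ((p - Pi.single i 1 : ι → ℤ) j) := fun j hj => by
    simp [Finset.ne_of_mem_erase hj]
  rw [gammaCoeff, gammaCoeff, ← Finset.prod_erase_mul _ _ (Finset.mem_univ i),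
    ← Finset.prod_erase_mul _ _ (Finset.mem_univ i), Finset.prod_congr rfl hne, mul_assoc]
  simp only [Pi.sub_apply, Pi.single_eq_same, gammaFactor_sub_one_mul (D i) hp]

theorem map_gammaCoeff {S : Type*} [CommRing S] (φ : R ≃+* S) (D : ι → R) (p : ι → ℤ) :
    φ (gammaCoeff D p) = gammaCoeff (fun i => φ (D i)) p := by
  simp [gammaCoeff, map_gammaFactor]

end GammaFactor

section GammaBound

theorem norm_prod_le_norm_one_mul_prod {A ι : Type*} [NormedCommRing A] (s : Finset ι)
    {f : ι → A} {b : ι → ℝ} (h : ∀ i ∈ s, ‖f i‖ ≤ b i) :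
    ‖∏ i ∈ s, f i‖ ≤ ‖(1 : A)‖ * ∏ i ∈ s, b i := by
  classical
  induction s using Finset.induction_on with
  | empty => simp
  | insert i s hi ih =>
    rw [Finset.forall_mem_insert] at h
    rw [Finset.prod_insert hi, Finset.prod_insert hi, mul_left_comm]
    exact (norm_mul_le _ _).trans
      (mul_le_mul h.1 (ih h.2) (norm_nonneg _) ((norm_nonneg _).trans h.1))

theorem norm_prod_sub_natCast_le {A : Type*} [NormedCommRing A] (x : A) (m : ℕ) :
    ‖∏ j ∈ range m, (x - (j : A))‖ ≤ ‖(1 : A)‖ * ((‖x‖ + ‖(1 : A)‖) ^ m * m.factorial) := by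
  have h : ∀ j ∈ range m, ‖x - (j : A)‖ ≤ (‖x‖ + ‖(1 : A)‖) * ((j + 1 : ℕ) : ℝ) := fun j _ => by
    have hj : ‖(j : A)‖ ≤ j * ‖(1 : A)‖ := by simpa using norm_nsmul_le (n := j) (a := (1 : A))
    calc ‖x - (j : A)‖ ≤ ‖x‖ + ‖(j : A)‖ := norm_sub_le _ _
      _ ≤ (‖x‖ + ‖(1 : A)‖) * ((j + 1 : ℕ) : ℝ) := by
        have := mul_nonneg (Nat.cast_nonneg (α := ℝ) j) (norm_nonneg x)
        push_cast
        linarith [norm_nonneg (1 : A)]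
  refine (norm_prod_le_norm_one_mul_prod _ h).trans_eq ?_
  rw [Finset.prod_mul_distrib, Finset.prod_const, Finset.card_range,
    ← Finset.prod_range_add_one_eq_factorial, Nat.cast_prod]

variable {A : Type*} [NormedCommRing A] [NormedAlgebra ℂ A] [CompleteSpace A]

open Filter Bornology in
theorem exists_norm_inverse_add_natCast_succ_le (x : A) :
    ∃ C : ℝ, 0 < C ∧
      ∀ j : ℕ, ‖Ring.inverse (x + ((j + 1 : ℕ) : A))‖ ≤ C * ((j + 1 : ℕ) : ℝ)⁻¹ := by
  have hlim : Tendsto (fun j : ℕ => ((j + 1 : ℕ) : ℂ)) atTop (cobounded ℂ) :=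
    tendsto_natCast_atTop_cobounded.comp (tendsto_add_atTop_nat 1)
  obtain ⟨C, hC, h⟩ := Asymptotics.bound_of_isBigO_nat_atTop
    ((spectrum.resolvent_isBigO_inv (𝕜 := ℂ) (-x)).comp_tendsto hlim)
  refine ⟨C, hC, fun j => ?_⟩
  have hj := h (x := j) (inv_ne_zero (Nat.cast_ne_zero.2 j.succ_ne_zero))
  rw [Function.comp_apply, Function.comp_apply, resolvent, map_natCast, sub_neg_eq_add, add_comm,
    norm_inv, Complex.norm_natCast] at hj
  exact hj

theorem exists_norm_inverse_prod_add_natCast_succ_le (x : A) :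
    ∃ C : ℝ, 0 < C ∧ ∀ m : ℕ, ‖Ring.inverse (∏ j ∈ range m, (x + ((j + 1 : ℕ) : A)))‖ ≤
      ‖(1 : A)‖ * (C ^ m / m.factorial) := by
  obtain ⟨C, hC, h⟩ := exists_norm_inverse_add_natCast_succ_le x
  refine ⟨C, hC, fun m => ?_⟩
  have hmap : Ring.inverse (∏ j ∈ range m, (x + ((j + 1 : ℕ) : A))) =
      ∏ j ∈ range m, Ring.inverse (x + ((j + 1 : ℕ) : A)) :=
    map_prod (MonoidWithZero.inverse : A →*₀ A) _ _
  rw [hmap]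
  refine (norm_prod_le_norm_one_mul_prod _ fun j _ => h j).trans_eq ?_
  rw [Finset.prod_mul_distrib, Finset.prod_const, Finset.card_range, Finset.prod_inv_distrib,
    ← Nat.cast_prod, Finset.prod_range_add_one_eq_factorial, div_eq_mul_inv]

theorem exists_norm_gammaFactor_le (x : A) :
    ∃ K C : ℝ, 0 ≤ K ∧ 0 ≤ C ∧ ∀ k : ℤ, ‖gammaFactor x k‖ ≤
      K * C ^ k.natAbs * ((-k).toNat.factorial / k.toNat.factorial) := by
  obtain ⟨C₁, hC₁, hden⟩ := exists_norm_inverse_prod_add_natCast_succ_le x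
  set C := max C₁ (‖x‖ + ‖(1 : A)‖)
  refine ⟨‖(1 : A)‖ * ‖(1 : A)‖, C, by positivity, by positivity, fun k => ?_⟩
  have hk : k.natAbs = (-k).toNat + k.toNat := by omega
  calc ‖gammaFactor x k‖ ≤ _ := norm_mul_le _ _
    _ ≤ (‖(1 : A)‖ * ((‖x‖ + ‖(1 : A)‖) ^ (-k).toNat * (-k).toNat.factorial)) *
        (‖(1 : A)‖ * (C₁ ^ k.toNat / k.toNat.factorial)) :=
      mul_le_mul (norm_prod_sub_natCast_le x _) (hden _) (norm_nonneg _) (by positivity)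
    _ ≤ (‖(1 : A)‖ * (C ^ (-k).toNat * (-k).toNat.factorial)) *
        (‖(1 : A)‖ * (C ^ k.toNat / k.toNat.factorial)) := by
      gcongr
      · exact le_max_right _ _
      · exact le_max_left _ _
    _ = _ := by rw [hk, pow_add]; ring

theorem factorial_sum_le_card_pow_mul_prod_factorial {ι : Type*} [Fintype ι] (q : ι → ℕ) :
    (∑ i, q i).factorial ≤ Fintype.card ι ^ (∑ i, q i) * ∏ i, (q i).factorial := by
  classical
  rw [← Nat.multinomial_spec, mul_comm]
  refine Nat.mul_le_mul_right _ ?_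
  have h := Finset.sum_pow_eq_sum_piAntidiag (R := ℕ) Finset.univ (fun _ : ι => 1) (∑ i, q i)
  simp only [Finset.sum_const, Finset.card_univ, smul_eq_mul, mul_one, one_pow,
    Finset.prod_const_one] at h
  rw [h]
  exact Finset.single_le_sum (f := fun k => Nat.multinomial Finset.univ k)
    (fun _ _ => Nat.zero_le _) (by simp [Finset.mem_piAntidiag])

theorem prod_factorial_neg_div_factorial_le {ι : Type*} [Fintype ι] (p : ι → ℤ) :
    ∏ i, ((-p i).toNat.factorial / (p i).toNat.factorial : ℝ) ≤
      (∑ i, p i).natAbs.factorial * (((Fintype.card ι + 1 : ℕ) : ℝ) ^ 2) ^ ∑ i, (p i).natAbs := by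
  set t := (∑ i, p i).natAbs
  have hsum : ∑ i, p i = (∑ i, (p i).toNat : ℕ) - (∑ i, (-p i).toNat : ℕ) := by
    simp only [Nat.cast_sum, ← Finset.sum_sub_distrib, Int.toNat_sub_toNat_neg]
  have habs : ∑ i, (p i).natAbs = ∑ i, (p i).toNat + ∑ i, (-p i).toNat := by
    rw [← Finset.sum_add_distrib]
    exact Finset.sum_congr rfl fun i _ => by omega
  have key : ∏ i, (-p i).toNat.factorial ≤
      t.factorial * (Fintype.card ι + 1) ^ (2 * ∑ i, (p i).natAbs) *
        ∏ i, (p i).toNat.factorial :=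
    calc ∏ i, (-p i).toNat.factorial ≤ (∑ i, (-p i).toNat).factorial :=
          Nat.le_of_dvd (Nat.factorial_pos _) (Nat.prod_factorial_dvd_factorial_sum _ _)
      _ ≤ (t + ∑ i, (p i).toNat).factorial := Nat.factorial_le (by omega)
      _ ≤ (Fintype.card ι + 1) ^ (t + ∑ i, (p i).toNat) *
          (t.factorial * ∏ i, (p i).toNat.factorial) := by
        simpa using factorial_sum_le_card_pow_mul_prod_factorial
          (fun o : Option ι => o.elim t fun i => (p i).toNat)
      _ ≤ (Fintype.card ι + 1) ^ (2 * ∑ i, (p i).natAbs) *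
          (t.factorial * ∏ i, (p i).toNat.factorial) :=
        Nat.mul_le_mul_right _ (Nat.pow_le_pow_right (Nat.succ_pos _) (by omega))
      _ = _ := by ring
  rw [Finset.prod_div_distrib, div_le_iff₀ (by positivity), ← pow_mul]
  exact_mod_cast key

theorem exists_norm_gammaCoeff_le {ι : Type*} [Fintype ι] (D : ι → A) :
    ∃ C : ℝ, 1 ≤ C ∧ ∀ t : ℤ, ∃ K : ℝ, ∀ p : ι → ℤ, ∑ i, p i = t →
      ‖gammaCoeff D p‖ ≤ K * C ^ ∑ i, (p i).natAbs := by
  choose K C hK hC h using fun i => exists_norm_gammaFactor_le (D i)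
  obtain ⟨B, hB⟩ := (Set.finite_range C).bddAbove
  set C' := max 1 B
  have hle : ∀ i, C i ≤ C' := fun i => (hB (Set.mem_range_self i)).trans (le_max_right _ _)
  have h1C' : 1 ≤ C' := le_max_left _ _
  refine ⟨C' * ((Fintype.card ι + 1 : ℕ) : ℝ) ^ 2,
    one_le_mul_of_one_le_of_one_le h1C' (one_le_pow₀ (by simp)), fun t =>
    ⟨‖(1 : A)‖ * (∏ i, K i) * t.natAbs.factorial, fun p hp => ?_⟩⟩
  have hfactor : ∀ i ∈ Finset.univ, ‖gammaFactor (D i) (p i)‖ ≤ K i * C' ^ (p i).natAbs *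
      ((-p i).toNat.factorial / (p i).toNat.factorial) := fun i _ => (h i (p i)).trans (by
    gcongr
    exacts [hK i, hC i, hle i])
  have hKprod : 0 ≤ ∏ i, K i := Finset.prod_nonneg fun i _ => hK i
  calc ‖gammaCoeff D p‖ ≤ ‖(1 : A)‖ * ((∏ i, K i) * C' ^ (∑ i, (p i).natAbs) *
        ∏ i, ((-p i).toNat.factorial / (p i).toNat.factorial : ℝ)) := by
        refine (norm_prod_le_norm_one_mul_prod _ hfactor).trans_eq ?_
        rw [Finset.prod_mul_distrib, Finset.prod_mul_distrib, Finset.prod_pow_eq_pow_sum]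
    _ ≤ ‖(1 : A)‖ * ((∏ i, K i) * C' ^ (∑ i, (p i).natAbs) * ((∑ i, p i).natAbs.factorial *
        (((Fintype.card ι + 1 : ℕ) : ℝ) ^ 2) ^ ∑ i, (p i).natAbs)) := by
        gcongr
        exact prod_factorial_neg_div_factorial_le p
    _ = _ := by rw [hp, mul_pow]; ring

end GammaBound

/-! ### Power series indexed by words -/

section WordSeries

variable {κ : Type*}

/-- Words over the alphabet `κ`, tagged by their length: those of length `N` index the terms of
degree `N` of a power series in the variables `κ`. -/
abbrev Word (κ : Type*) : Type _ := Σ N : ℕ, Fin N → κ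

theorem norm_prod_word_le {z : κ → ℂ} {r : ℝ} (hz : ∀ k, ‖z k‖ ≤ r) (σ : Word κ) :
    ‖∏ k, z (σ.2 k)‖ ≤ r ^ σ.1 := by
  simpa [norm_prod] using Finset.prod_le_prod (s := Finset.univ)
    (fun k _ => norm_nonneg (z (σ.2 k))) fun k _ => hz (σ.2 k)

variable [Fintype κ]

theorem summable_pow_word_length {ρ : ℝ} (h0 : 0 ≤ ρ) (h1 : Fintype.card κ * ρ < 1) :
    Summable fun σ : Word κ => ρ ^ σ.1 := by
  classical
  rw [summable_sigma_of_nonneg fun σ => pow_nonneg h0 _]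
  refine ⟨fun N => (hasSum_fintype _).summable, ?_⟩
  have hlength : ∀ N : ℕ, ∑' _ : Fin N → κ, ρ ^ N = (Fintype.card κ * ρ) ^ N := fun N => by
    simp [tsum_fintype, mul_pow]
  simp only [hlength]
  exact summable_geometric_of_lt_one (by positivity) h1

variable {E : Type*} [NormedAddCommGroup E] [NormedSpace ℂ E]

/-- The power series in the variables `κ` with one term for each word; words which differ by a
permutation of their letters give the same monomial. -/
def wordSeries (d : Word κ → E) (z : κ → ℂ) : E := ∑' σ : Word κ, (∏ k, z (σ.2 k)) • d σ

/-- `wordSeries d` as a formal power series. -/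
def wordFormalSeries (d : Word κ → E) : FormalMultilinearSeries ℂ (κ → ℂ) E := fun N =>
  ∑ σ : Fin N → κ, ((ContinuousMultilinearMap.mkPiAlgebra ℂ (Fin N) ℂ).compContinuousLinearMap
    fun k => ContinuousLinearMap.proj (R := ℂ) (φ := fun _ : κ => ℂ) (σ k)).smulRight (d ⟨N, σ⟩)

theorem wordFormalSeries_apply (d : Word κ → E) (N : ℕ) (z : Fin N → κ → ℂ) :
    wordFormalSeries d N z = ∑ σ : Fin N → κ, (∏ k, z k (σ k)) • d ⟨N, σ⟩ := by
  simp [wordFormalSeries]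

variable {d : Word κ → E} {K r ε : ℝ}

theorem norm_wordFormalSeries_le (hK : 0 ≤ K) (hr : 0 ≤ r) (hd : ∀ σ, ‖d σ‖ ≤ K * r ^ σ.1)
    (N : ℕ) : ‖wordFormalSeries d N‖ ≤ K * (Fintype.card κ * r) ^ N := by
  refine ContinuousMultilinearMap.opNorm_le_bound (by positivity) fun z => ?_
  rw [wordFormalSeries_apply]
  calc ‖∑ σ : Fin N → κ, (∏ k, z k (σ k)) • d ⟨N, σ⟩‖
      ≤ ∑ _σ : Fin N → κ, (∏ k, ‖z k‖) * (K * r ^ N) := by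
        refine norm_sum_le_of_le _ fun σ _ => ?_
        rw [norm_smul, norm_prod]
        exact mul_le_mul (Finset.prod_le_prod (fun _ _ => norm_nonneg _)
          fun k _ => norm_le_pi_norm _ _) (hd _) (norm_nonneg _) (by positivity)
    _ = K * (Fintype.card κ * r) ^ N * ∏ k, ‖z k‖ := by
        simp [mul_pow]
        ring

theorem le_radius_wordFormalSeries (hK : 0 ≤ K) (hr : 0 ≤ r) (hε : 0 ≤ ε)
    (hd : ∀ σ, ‖d σ‖ ≤ K * r ^ σ.1) (hlt : Fintype.card κ * (r * ε) < 1) :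
    ENNReal.ofReal ε ≤ (wordFormalSeries d).radius := by
  refine FormalMultilinearSeries.le_radius_of_bound _ K fun N => ?_
  rw [Real.coe_toNNReal _ hε]
  calc ‖wordFormalSeries d N‖ * ε ^ N ≤ K * (Fintype.card κ * r) ^ N * ε ^ N := by
        gcongr
        exact norm_wordFormalSeries_le hK hr hd N
    _ = K * (Fintype.card κ * (r * ε)) ^ N := by rw [mul_assoc, ← mul_pow, mul_assoc]
    _ ≤ K := mul_le_of_le_one_right hK (pow_le_one₀ (by positivity) hlt.le)

variable [CompleteSpace E]

theorem summable_wordSeries (hr : 0 ≤ r) (hε : 0 ≤ ε) (hd : ∀ σ, ‖d σ‖ ≤ K * r ^ σ.1)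
    (hlt : Fintype.card κ * (r * ε) < 1) {z : κ → ℂ} (hz : ∀ k, ‖z k‖ ≤ ε) :
    Summable fun σ : Word κ => (∏ k, z (σ.2 k)) • d σ := by
  refine Summable.of_norm_bounded
    ((summable_pow_word_length (mul_nonneg hr hε) hlt).mul_left K) fun σ => ?_
  calc ‖(∏ k, z (σ.2 k)) • d σ‖ = ‖∏ k, z (σ.2 k)‖ * ‖d σ‖ := norm_smul _ _
    _ ≤ ε ^ σ.1 * (K * r ^ σ.1) :=
      mul_le_mul (norm_prod_word_le hz σ) (hd σ) (norm_nonneg _) (by positivity)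
    _ = K * (r * ε) ^ σ.1 := by rw [mul_pow]; ring

theorem analyticOnNhd_wordSeries (hK : 0 ≤ K) (hr : 0 ≤ r) (hε : 0 < ε)
    (hd : ∀ σ, ‖d σ‖ ≤ K * r ^ σ.1) (hlt : Fintype.card κ * (r * ε) < 1) :
    AnalyticOnNhd ℂ (wordSeries d) (Metric.ball 0 ε) := by
  have hrad := le_radius_wordFormalSeries hK hr hε.le hd hlt
  have hball : Metric.ball (0 : κ → ℂ) ε ⊆ Metric.eball 0 (wordFormalSeries d).radius := by
    rw [← Metric.eball_ofReal]
    exact Metric.eball_subset_eball hrad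
  refine (((wordFormalSeries d).hasFPowerSeriesOnBall
    ((ENNReal.ofReal_pos.2 hε).trans_le hrad)).analyticOnNhd.mono hball).congr
      Metric.isOpen_ball fun z hz => ?_
  have hz' : ∀ k, ‖z k‖ ≤ ε := fun k =>
    (norm_le_pi_norm z k).trans (mem_ball_zero_iff.1 hz).le
  rw [wordSeries, (summable_wordSeries hr hε.le hd hlt hz').tsum_sigma'
    fun N => (hasSum_fintype _).summable]
  exact tsum_congr fun N => by rw [wordFormalSeries_apply, tsum_fintype]

end WordSeries

/-! ### Laurent series supported on a finitely generated monoid -/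

section Laurent

variable {ι κ : Type*}

/-- The sum of the exponents in a word. -/
def wordSum (g : κ → ι → ℤ) (σ : Word κ) : ι → ℤ := ∑ k, g (σ.2 k)

theorem injective_of_wordSum_eq {g : κ → ι → ℤ} {S : Set (ι → ℤ)} {m : ι → ℤ}
    {w : (ι → ℤ) → Word κ} (hw : ∀ p : S, wordSum g (w p) = p + m) :
    Function.Injective fun p : S => w p := fun p q hpq => by
  have hsum := hw p
  rw [show w p = w q from hpq, hw q] at hsum
  exact Subtype.ext (add_right_cancel hsum.symm)

variable [Fintype ι]

/-- The Laurent monomial `∏ a_i ^ p_i` in variables indexed by an arbitrary finite type. -/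
def laurent (a : ι → ℂ) (p : ι → ℤ) : ℂ := ∏ i, a i ^ p i

theorem laurent_add {a : ι → ℂ} (ha : ∀ i, a i ≠ 0) (p q : ι → ℤ) :
    laurent a (p + q) = laurent a p * laurent a q := by
  simp only [laurent, Pi.add_apply, ← Finset.prod_mul_distrib]
  exact Finset.prod_congr rfl fun i _ => zpow_add₀ (ha i) _ _

theorem laurent_sum {a : ι → ℂ} (ha : ∀ i, a i ≠ 0) {J : Type*} (s : Finset J) (p : J → ι → ℤ) :
    laurent a (∑ j ∈ s, p j) = ∏ j ∈ s, laurent a (p j) := by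
  classical
  induction s using Finset.induction_on with
  | empty => simp [laurent]
  | insert j s hj ih => rw [Finset.sum_insert hj, Finset.prod_insert hj, laurent_add ha, ih]

theorem laurent_sub_single [DecidableEq ι] {a : ι → ℂ} (ha : ∀ i, a i ≠ 0) (p : ι → ℤ) (v : ι) :
    laurent a (p - Pi.single v 1) = laurent a p * (a v)⁻¹ := by
  have hsingle : laurent a (-Pi.single v 1) = (a v)⁻¹ := by
    rw [laurent, Fintype.prod_eq_single v fun i hi => by simp [hi]]
    simp
  rw [sub_eq_add_neg, laurent_add ha, hsingle]

theorem analyticAt_laurent {a : ι → ℂ} (ha : ∀ i, a i ≠ 0) (p : ι → ℤ) :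
    AnalyticAt ℂ (fun b => laurent b p) a :=
  Finset.analyticAt_fun_prod _ fun i _ =>
    ((ContinuousLinearMap.proj (R := ℂ) (φ := fun _ : ι => ℂ) i).analyticAt a).zpow (ha i)

theorem hasLineDerivAt_laurent [DecidableEq ι] {a : ι → ℂ} (ha : ∀ i, a i ≠ 0) (p : ι → ℤ)
    (v : ι) : HasLineDerivAt ℂ (fun b => laurent b p)
      ((p v : ℂ) * laurent a (p - Pi.single v 1)) a (Pi.single v 1) := by
  have hfactor : (fun t : ℂ => laurent (a + t • Pi.single v (1 : ℂ)) p) = fun t : ℂ =>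
      (a v + t) ^ p v * ∏ i ∈ Finset.univ.erase v, a i ^ p i := by
    funext t
    rw [laurent, ← Finset.mul_prod_erase _ _ (Finset.mem_univ v)]
    refine congrArg₂ _ (by simp) (Finset.prod_congr rfl fun i hi => ?_)
    simp [Finset.ne_of_mem_erase hi]
  have hpow := (hasDerivAt_zpow (p v) (a v + 0) (Or.inl (by simpa using ha v))).comp 0
    ((hasDerivAt_id (0 : ℂ)).const_add (a v))
  rw [HasLineDerivAt, hfactor]
  refine (hpow.mul_const _).congr_deriv ?_
  rw [laurent_sub_single ha, laurent, ← Finset.mul_prod_erase _ _ (Finset.mem_univ v), add_zero,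
    zpow_sub_one₀ (ha v)]
  ring

/-- The part of the torus where the monomials with exponents `g k` are smaller than `ε`. -/
def smallRegion (g : κ → ι → ℤ) (ε : ℝ) : Set (ι → ℂ) :=
  {a | (∀ i, a i ≠ 0) ∧ ∀ k, ‖laurent a (g k)‖ < ε}

theorem isOpen_smallRegion [Finite κ] (g : κ → ι → ℤ) (ε : ℝ) : IsOpen (smallRegion g ε) := by
  rw [isOpen_iff_mem_nhds]
  rintro a ⟨ha, hg⟩
  have hne : ∀ᶠ b in 𝓝 a, ∀ i, b i ≠ 0 :=
    eventually_all.2 fun i => (continuous_apply i).continuousAt.eventually_ne (ha i)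
  have hlt : ∀ᶠ b in 𝓝 a, ∀ k, ‖laurent b (g k)‖ < ε :=
    eventually_all.2 fun k =>
      (analyticAt_laurent ha (g k)).continuousAt.norm.eventually_lt_const (hg k)
  filter_upwards [hne, hlt] with b hb1 hb2 using ⟨hb1, hb2⟩

theorem laurent_wordSum {a : ι → ℂ} (ha : ∀ i, a i ≠ 0) (g : κ → ι → ℤ) (σ : Word κ) :
    laurent a (wordSum g σ) = ∏ k, laurent a (g (σ.2 k)) :=
  laurent_sum ha _ _

theorem sum_natAbs_wordSum_le [Fintype κ] (g : κ → ι → ℤ) (σ : Word κ) :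
    ∑ i, (wordSum g σ i).natAbs ≤ σ.1 * ∑ k, ∑ i, (g k i).natAbs := by
  calc ∑ i, (wordSum g σ i).natAbs ≤ ∑ i, ∑ k, (g (σ.2 k) i).natAbs := by
        refine Finset.sum_le_sum fun i _ => ?_
        rw [wordSum, Finset.sum_apply]
        exact Int.natAbs_sum_le _ _
    _ = ∑ k, ∑ i, (g (σ.2 k) i).natAbs := Finset.sum_comm
    _ ≤ ∑ _k : Fin σ.1, ∑ k, ∑ i, (g k i).natAbs := Finset.sum_le_sum fun k _ =>
        Finset.single_le_sum (f := fun k => ∑ i, (g k i).natAbs) (fun _ _ => Nat.zero_le _)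
          (Finset.mem_univ _)
    _ = _ := by simp

variable {E : Type*} [NormedAddCommGroup E]

/-- The Laurent series with coefficients `c`. -/
def laurentSeries [NormedSpace ℂ E] (c : (ι → ℤ) → E) (a : ι → ℂ) : E :=
  ∑' p : ι → ℤ, laurent a p • c p

/-- The coefficients `c` are supported on a translate of the monoid generated by the exponents
`g`, and bounded by a geometric series along words in `g` which converges when the letters have
modulus less than `ε`. This makes `laurentSeries c` converge on `smallRegion g ε`. -/
def IsWordDominated [Fintype κ] (g : κ → ι → ℤ) (ε : ℝ) (c : (ι → ℤ) → E) : Prop :=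
  ∃ (m : ι → ℤ) (K r : ℝ) (w : (ι → ℤ) → Word κ),
    0 ≤ K ∧ 0 ≤ r ∧ Fintype.card κ * (r * ε) < 1 ∧
      ∀ p, c p ≠ 0 → wordSum g (w p) = p + m ∧ ‖c p‖ ≤ K * r ^ (w p).1

variable [Fintype κ] {g : κ → ι → ℤ} {ε : ℝ} {c : (ι → ℤ) → E}

theorem isWordDominated_of_norm_le {m : ι → ℤ} {K C : ℝ} (hC : 1 ≤ C)
    (hlt : Fintype.card κ * (C ^ (∑ k, ∑ i, (g k i).natAbs) * ε) < 1)
    (hword : ∀ p, c p ≠ 0 → ∃ σ, wordSum g σ = p + m)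
    (hle : ∀ p, c p ≠ 0 → ‖c p‖ ≤ K * C ^ ∑ i, (p i).natAbs) : IsWordDominated g ε c := by
  classical
  choose w hw using hword
  refine ⟨m, |K| * C ^ ∑ i, (m i).natAbs, C ^ ∑ k, ∑ i, (g k i).natAbs,
    fun p => if hp : c p ≠ 0 then w p hp else ⟨0, Fin.elim0⟩, by positivity, by positivity, hlt,
    fun p hp => ?_⟩
  simp only [dif_pos hp]
  refine ⟨hw p hp, ?_⟩
  have hlen : ∑ i, (p i).natAbs ≤
      ∑ i, (m i).natAbs + (∑ k, ∑ i, (g k i).natAbs) * (w p hp).1 := by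
    have htri : ∑ i, (p i).natAbs ≤ ∑ i, (((p + m) i).natAbs + (m i).natAbs) :=
      Finset.sum_le_sum fun i _ => by rw [Pi.add_apply]; omega
    have hsum := sum_natAbs_wordSum_le g (w p hp)
    rw [hw p hp, mul_comm] at hsum
    rw [Finset.sum_add_distrib] at htri
    omega
  calc ‖c p‖ ≤ |K| * C ^ ∑ i, (p i).natAbs :=
        (hle p hp).trans (by gcongr; exact le_abs_self K)
    _ ≤ |K| * C ^ (∑ i, (m i).natAbs + (∑ k, ∑ i, (g k i).natAbs) * (w p hp).1) := by gcongr
    _ = _ := by rw [pow_add, pow_mul, mul_assoc]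

variable [NormedSpace ℂ E]

theorem IsWordDominated.exists_summable_bound (h : IsWordDominated g ε c) (hε : 0 ≤ ε) :
    ∃ (m : ι → ℤ) (u : (ι → ℤ) → ℝ), Summable u ∧ (∀ p, 0 ≤ u p) ∧
      ∀ a ∈ smallRegion g ε, ∀ p, ‖laurent a p • c p‖ ≤ ‖laurent a m‖ * u p := by
  obtain ⟨m, K, r, w, hK, hr, hlt, h⟩ := h
  have hnonneg : ∀ p, 0 ≤ (Function.support c).indicator (fun p => K * (r * ε) ^ (w p).1) p :=
    fun p => Set.indicator_nonneg (fun _ _ => by positivity) p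
  refine ⟨-m, (Function.support c).indicator fun p => K * (r * ε) ^ (w p).1, ?_, hnonneg,
    fun a ha p => ?_⟩
  · have hinj := injective_of_wordSum_eq fun p : Function.support c => (h p p.2).1
    rw [← summable_subtype_iff_indicator]
    exact ((summable_pow_word_length (mul_nonneg hr hε) hlt).comp_injective hinj).mul_left K
  · by_cases hp : c p = 0
    · rw [hp, smul_zero, norm_zero]
      exact mul_nonneg (norm_nonneg _) (hnonneg p)
    obtain ⟨hsum, hle⟩ := h p hp
    have hmon : ‖laurent a p‖ ≤ ‖laurent a (-m)‖ * ε ^ (w p).1 := by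
      rw [show p = -m + wordSum g (w p) by rw [hsum]; abel, laurent_add ha.1, norm_mul,
        laurent_wordSum ha.1, ← show p = -m + wordSum g (w p) by rw [hsum]; abel]
      gcongr
      exact norm_prod_word_le (fun k => (ha.2 k).le) _
    rw [Set.indicator_of_mem (Function.mem_support.2 hp), norm_smul]
    calc ‖laurent a p‖ * ‖c p‖
        ≤ (‖laurent a (-m)‖ * ε ^ (w p).1) * (K * r ^ (w p).1) := by gcongr
      _ = _ := by rw [mul_pow]; ring

theorem IsWordDominated.exists_wordSeries (h : IsWordDominated g ε c) :
    ∃ (m : ι → ℤ) (K r : ℝ) (d : Word κ → E), 0 ≤ K ∧ 0 ≤ r ∧ Fintype.card κ * (r * ε) < 1 ∧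
      (∀ σ, ‖d σ‖ ≤ K * r ^ σ.1) ∧ ∀ a : ι → ℂ, (∀ i, a i ≠ 0) →
        laurentSeries c a = laurent a (-m) • wordSeries d fun k => laurent a (g k) := by
  obtain ⟨m, K, r, w, hK, hr, hlt, h⟩ := h
  have hinj := injective_of_wordSum_eq fun p : Function.support c => (h p p.2).1
  let d : Word κ → E := Function.extend (fun p : Function.support c => w p) (fun p => c p) 0
  have hd : ∀ p : Function.support c, d (w p) = c p := hinj.extend_apply _ _
  have hd0 : ∀ σ, σ ∉ Set.range (fun p : Function.support c => w p) → d σ = 0 := fun σ hσ =>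
    Function.extend_apply' _ _ σ hσ
  refine ⟨m, K, r, d, hK, hr, hlt, fun σ => ?_, fun a ha => ?_⟩
  · by_cases hσ : σ ∈ Set.range fun p : Function.support c => w p
    · obtain ⟨p, rfl⟩ := hσ
      rw [hd]
      exact (h p p.2).2
    · rw [hd0 σ hσ, norm_zero]
      positivity
  let F : Word κ → E := fun σ => laurent a (wordSum g σ - m) • d σ
  have hF : Function.support F ⊆ Set.range fun p : Function.support c => w p := fun σ hσ => by
    by_contra hσ'
    exact hσ (by simp only [F, hd0 σ hσ', smul_zero])
  calc laurentSeries c a = ∑' p : Function.support c, laurent a p • c p :=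
        (tsum_subtype_eq_of_support_subset fun p hp => right_ne_zero_of_smul hp).symm
    _ = ∑' p : Function.support c, F (w p) := tsum_congr fun p => by
        simp only [F, hd, (h p p.2).1, add_sub_cancel_right]
    _ = ∑' σ, F σ := hinj.tsum_eq hF
    _ = laurent a (-m) • wordSeries d fun k => laurent a (g k) := by
        rw [wordSeries, ← tsum_const_smul'']
        refine tsum_congr fun σ => ?_
        rw [smul_smul, ← laurent_wordSum ha, ← laurent_add ha, neg_add_eq_sub]

variable [CompleteSpace E]

theorem IsWordDominated.summable (h : IsWordDominated g ε c) (hε : 0 ≤ ε) {a : ι → ℂ}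
    (ha : a ∈ smallRegion g ε) : Summable fun p => laurent a p • c p := by
  obtain ⟨m, u, hu, -, hle⟩ := h.exists_summable_bound hε
  exact Summable.of_norm_bounded (hu.mul_left _) (hle a ha)

theorem IsWordDominated.analyticOnNhd (h : IsWordDominated g ε c) (hε : 0 < ε) :
    AnalyticOnNhd ℂ (laurentSeries c) (smallRegion g ε) := by
  obtain ⟨m, K, r, d, hK, hr, hlt, hd, hc⟩ := h.exists_wordSeries
  have hmaps : Set.MapsTo (fun (a : ι → ℂ) k => laurent a (g k)) (smallRegion g ε)
      (Metric.ball 0 ε) := fun a ha => by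
    rw [mem_ball_zero_iff, pi_norm_lt_iff hε]
    exact ha.2
  have hletters : AnalyticOnNhd ℂ (fun (a : ι → ℂ) k => laurent a (g k)) (smallRegion g ε) :=
    fun a ha => AnalyticAt.pi fun k => analyticAt_laurent ha.1 _
  have hshift : AnalyticOnNhd ℂ (fun a : ι → ℂ => laurent a (-m)) (smallRegion g ε) :=
    fun a ha => analyticAt_laurent ha.1 _
  exact (hshift.smul ((analyticOnNhd_wordSeries hK hr hε hd hlt).comp hletters hmaps)).congr
    (isOpen_smallRegion g ε) fun a ha => (hc a ha.1).symm

theorem IsWordDominated.hasSum_lineDeriv [DecidableEq ι] (h : IsWordDominated g ε c) (hε : 0 ≤ ε)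
    {a : ι → ℂ} (ha : a ∈ smallRegion g ε) (v : ι) :
    HasSum (fun p : ι → ℤ => ((p v : ℂ) * laurent a (p - Pi.single v 1)) • c p)
      (lineDeriv ℂ (laurentSeries c) a (Pi.single v 1)) := by
  obtain ⟨m, u, hu, hu0, hle⟩ := h.exists_summable_bound hε
  have hW : smallRegion g ε ∩ {b | ‖laurent b m‖ < ‖laurent a m‖ + 1} ∈ 𝓝 a :=
    Filter.inter_mem ((isOpen_smallRegion g ε).mem_nhds ha)
      ((analyticAt_laurent ha.1 m).continuousAt.norm.eventually_lt_const (lt_add_one _))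
  obtain ⟨V, hVW, hVopen, haV⟩ := mem_nhds_iff.1 hW
  let line : ℂ → ι → ℂ := fun t => a + t • Pi.single v (1 : ℂ)
  have hline : Differentiable ℂ line := by fun_prop
  have key := Complex.hasSum_deriv_of_summable_norm (U := line ⁻¹' V) (z := 0)
    (F := fun p t => laurent (line t) p • c p) (hu.mul_left (‖laurent a m‖ + 1)) ?_
    (hVopen.preimage hline.continuous) ?_ (by simpa [line] using haV)
  · have hterm : ∀ p, HasDerivAt (fun t => laurent (line t) p)
        ((p v : ℂ) * laurent a (p - Pi.single v 1)) 0 := fun p => hasLineDerivAt_laurent ha.1 p v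
    exact key.congr_fun fun p => ((hterm p).smul_const (c p)).deriv.symm
  · intro p t ht
    exact ((((analyticAt_laurent (hVW ht).1.1 p).differentiableAt.comp t
      hline.differentiableAt).smul_const (c p))).differentiableWithinAt
  · intro p t ht
    exact (hle _ (hVW ht).1 p).trans (mul_le_mul_of_nonneg_right (le_of_lt (hVW ht).2) (hu0 p))

end Laurent

/-! ### Gamma series -/

section LogBranch

variable {ι : Type*} {U : Set (ι → ℂ)} {lg : (ι → ℂ) → (ι → ℂ)}

/-- `lg` is a system of continuous branches of the logarithms of the coordinates on the open
set `U`. -/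
structure IsLogBranch (U : Set (ι → ℂ)) (lg : (ι → ℂ) → (ι → ℂ)) : Prop where
  isOpen : IsOpen U
  continuousOn : ContinuousOn lg U
  exp_eq : ∀ a ∈ U, ∀ v, Complex.exp (lg a v) = a v

namespace IsLogBranch

theorem ne_zero (h : IsLogBranch U lg) {a : ι → ℂ} (ha : a ∈ U) (v : ι) : a v ≠ 0 := by
  rw [← h.exp_eq a ha v]
  exact Complex.exp_ne_zero _

theorem eventually_eq_add_log (h : IsLogBranch U lg) {a : ι → ℂ} (ha : a ∈ U) (v : ι) :
    ∀ᶠ b in 𝓝 a, lg b v = lg a v + Complex.log (b v / a v) := by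
  have hU : U ∈ 𝓝 a := h.isOpen.mem_nhds ha
  have him : ContinuousAt (fun b => (lg b v - lg a v).im) a :=
    Complex.continuous_im.continuousAt.comp
      (((continuous_apply v).continuousAt.comp (h.continuousOn.continuousAt hU)).sub_const _)
  filter_upwards [him.eventually_const_lt (by simpa using Real.pi_pos : -Real.pi < _),
    him.eventually_lt_const (by simpa using Real.pi_pos : _ < Real.pi), hU] with b hlower hupper hb
  have hquot : b v / a v = Complex.exp (lg b v - lg a v) := by
    rw [Complex.exp_sub, h.exp_eq a ha, h.exp_eq b hb]
  rw [hquot, Complex.log_exp hlower hupper.le]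
  ring

theorem analyticAt [Fintype ι] (h : IsLogBranch U lg) {a : ι → ℂ} (ha : a ∈ U) (v : ι) :
    AnalyticAt ℂ (fun b => lg b v) a := by
  have hav := h.ne_zero ha v
  have hproj : AnalyticAt ℂ (fun b : ι → ℂ => b v) a :=
    (ContinuousLinearMap.proj (R := ℂ) (φ := fun _ : ι => ℂ) v).analyticAt a
  have hlog : AnalyticAt ℂ (fun b : ι → ℂ => lg a v + Complex.log (b v / a v)) a :=
    analyticAt_const.add ((hproj.div analyticAt_const hav).clog (by simp [div_self hav]))
  exact hlog.congr ((h.eventually_eq_add_log ha v).mono fun b hb => hb.symm)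

theorem hasFDerivAt [Finite ι] (h : IsLogBranch U lg) {a : ι → ℂ} (ha : a ∈ U) (v : ι) :
    HasFDerivAt (fun b => lg b v)
      ((a v)⁻¹ • ContinuousLinearMap.proj (R := ℂ) (φ := fun _ : ι => ℂ) v) a := by
  have := Fintype.ofFinite ι
  have hav := h.ne_zero ha v
  have hquot : HasFDerivAt (fun b : ι → ℂ => b v / a v)
      ((a v)⁻¹ • ContinuousLinearMap.proj (R := ℂ) (φ := fun _ : ι => ℂ) v) a := by
    simp only [div_eq_mul_inv]
    exact (hasFDerivAt_apply (𝕜 := ℂ) v a).mul_const (a v)⁻¹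
  refine HasFDerivAt.congr_of_eventuallyEq ?_ (h.eventually_eq_add_log ha v)
  simpa [div_self hav] using (hquot.clog (by simp [div_self hav])).const_add (lg a v)

end IsLogBranch

variable [Fintype ι] {A : Type*} [NormedCommRing A] [NormedAlgebra ℂ A] [CompleteSpace A]

/-- The multivalued monomial `∏ a_v ^ D_v = exp (∑ log a_v • D_v)` with exponents in an algebra. -/
def expFactor (lg : (ι → ℂ) → (ι → ℂ)) (D : ι → A) (a : ι → ℂ) : A :=
  NormedSpace.exp (∑ v, lg a v • D v)

theorem analyticAt_expFactor (h : IsLogBranch U lg) (D : ι → A) {a : ι → ℂ} (ha : a ∈ U) :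
    AnalyticAt ℂ (expFactor lg D) a :=
  AnalyticAt.fun_comp (f := fun b => ∑ v, lg b v • D v)
    (NormedSpace.exp_analytic (𝕂 := ℂ) (∑ v, lg a v • D v))
    (Finset.analyticAt_fun_sum _ fun v _ => (h.analyticAt ha v).smul analyticAt_const)

theorem hasLineDerivAt_expFactor [DecidableEq ι] (h : IsLogBranch U lg) (D : ι → A) {a : ι → ℂ}
    (ha : a ∈ U) (v : ι) :
    HasLineDerivAt ℂ (expFactor lg D) ((a v)⁻¹ • (D v * expFactor lg D a)) a (Pi.single v 1) := by
  have hsum := HasFDerivAt.fun_sum (u := Finset.univ) fun w _ =>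
    (h.hasFDerivAt ha w).smul_const (D w)
  have hexp : HasFDerivAt (expFactor lg D) _ a :=
    (hasFDerivAt_exp (𝕂 := ℂ) (x := ∑ w, lg a w • D w)).comp a hsum
  have hvalue : (a v)⁻¹ • (D v * expFactor lg D a) =
      ((NormedSpace.exp (∑ w, lg a w • D w) • (1 : A →L[ℂ] A)).comp
        (∑ w, ((a w)⁻¹ • ContinuousLinearMap.proj (R := ℂ) (φ := fun _ : ι => ℂ) w).smulRight
          (D w))) (Pi.single v 1) := by
    simp [expFactor, Pi.single_apply, mul_comm]
  rw [hvalue]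
  exact hexp.hasLineDerivAt (Pi.single v 1)

end LogBranch

section GammaCoeffOfDegree

variable {ι : Type*} [Fintype ι] {A : Type*} [CommRing A] {Λ : Type*} [AddCommGroup Λ]

/-- The coefficients of the gamma series of degree `d`. -/
def gammaCoeffOfDegree (D : ι → A) (deg : (ι → ℤ) →+ Λ) (d : Λ) : (ι → ℤ) → A :=
  {p | deg p = d}.indicator (gammaCoeff D)

variable {D : ι → A} {deg : (ι → ℤ) →+ Λ} {d : Λ} {p : ι → ℤ}

theorem gammaCoeffOfDegree_of_eq (hp : deg p = d) :
    gammaCoeffOfDegree D deg d p = gammaCoeff D p :=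
  Set.indicator_of_mem (s := {p | deg p = d}) hp _

theorem eq_of_gammaCoeffOfDegree_ne_zero (hp : gammaCoeffOfDegree D deg d p ≠ 0) : deg p = d :=
  Set.mem_of_indicator_ne_zero (s := {p | deg p = d}) hp

end GammaCoeffOfDegree

section GammaSeries

variable {ι κ : Type*} [Fintype ι] [Fintype κ] {A : Type*} [NormedCommRing A]
  [NormedAlgebra ℂ A] [CompleteSpace A] {g : κ → ι → ℤ} {ε : ℝ} {U : Set (ι → ℂ)}
  {lg : (ι → ℂ) → (ι → ℂ)}

theorem hasSum_lineDeriv_laurentSeries_mul_expFactor [DecidableEq ι] {c : (ι → ℤ) → A}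
    (hc : IsWordDominated g ε c) (hε : 0 < ε) (hlg : IsLogBranch U lg)
    (hU : U ⊆ smallRegion g ε) (D : ι → A) {a : ι → ℂ} (ha : a ∈ U) (v : ι) :
    HasSum (fun p => laurent a (p - Pi.single v 1) • ((D v + (p v : A)) * c p) * expFactor lg D a)
      (lineDeriv ℂ (fun b => laurentSeries c b * expFactor lg D b) a (Pi.single v 1)) := by
  have hseries : HasDerivAt (fun t : ℂ => laurentSeries c (a + t • Pi.single v (1 : ℂ)))
      (lineDeriv ℂ (laurentSeries c) a (Pi.single v 1)) 0 :=
    ((hc.analyticOnNhd hε a (hU ha)).differentiableAt.lineDifferentiableAt).hasLineDerivAt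
  have hfactor : HasDerivAt (fun t : ℂ => expFactor lg D (a + t • Pi.single v (1 : ℂ)))
      ((a v)⁻¹ • (D v * expFactor lg D a)) 0 := hasLineDerivAt_expFactor hlg D ha v
  have hprod : lineDeriv ℂ (fun b => laurentSeries c b * expFactor lg D b) a (Pi.single v 1) =
      lineDeriv ℂ (laurentSeries c) a (Pi.single v 1) * expFactor lg D a +
        laurentSeries c a * ((a v)⁻¹ • (D v * expFactor lg D a)) := by
    simpa [lineDeriv] using (hseries.fun_mul hfactor).deriv
  rw [hprod]
  refine (((hc.hasSum_lineDeriv hε.le (hU ha) v).mul_right _).add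
    ((hc.summable hε.le (hU ha)).hasSum.mul_right _)).congr_fun fun p => ?_
  simp only [Algebra.smul_def, map_mul, map_intCast, laurent_sub_single (hlg.ne_zero ha)]
  ring

variable {Λ : Type*} [AddCommGroup Λ]

/-- The gamma series: the sum of `a ^ (p + D) / Γ(p + D + 1)`, in the normalization `gammaCoeff`,
over the exponents `p` of degree `d`. -/
def gammaSeries (D : ι → A) (lg : (ι → ℂ) → (ι → ℂ)) (deg : (ι → ℤ) →+ Λ) (d : Λ)
    (a : ι → ℂ) : A :=
  laurentSeries (gammaCoeffOfDegree D deg d) a * expFactor lg D a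

variable {D : ι → A} {deg : (ι → ℤ) →+ Λ} {d : Λ}

theorem analyticOnNhd_gammaSeries (hd : IsWordDominated g ε (gammaCoeffOfDegree D deg d))
    (hε : 0 < ε) (hlg : IsLogBranch U lg) (hU : U ⊆ smallRegion g ε) :
    AnalyticOnNhd ℂ (gammaSeries D lg deg d) U := fun a ha =>
  (hd.analyticOnNhd hε a (hU ha)).mul (analyticAt_expFactor hlg D ha)

variable [DecidableEq ι]

theorem lineDeriv_gammaSeries (hD : ∀ i, IsNilpotent (D i)) {v : ι}
    (hd : IsWordDominated g ε (gammaCoeffOfDegree D deg d))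
    (hd' : IsWordDominated g ε (gammaCoeffOfDegree D deg (d - deg (Pi.single v 1))))
    (hε : 0 < ε) (hlg : IsLogBranch U lg) (hU : U ⊆ smallRegion g ε) {a : ι → ℂ} (ha : a ∈ U) :
    lineDeriv ℂ (gammaSeries D lg deg d) a (Pi.single v 1) =
      gammaSeries D lg deg (d - deg (Pi.single v 1)) a := by
  refine (hasSum_lineDeriv_laurentSeries_mul_expFactor hd hε hlg hU D ha v).unique
    (((Equiv.subRight (Pi.single v (1 : ℤ))).hasSum_iff.2
      ((hd'.summable hε.le (hU ha)).hasSum.mul_right (expFactor lg D a))).congr_fun fun p => ?_)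
  simp only [Function.comp_apply, Equiv.subRight_apply]
  congr 2
  by_cases hp : deg p = d <;>
    simp [gammaCoeffOfDegree, hp, add_mul_gammaCoeff ℂ hD]

theorem sum_mul_lineDeriv_gammaSeries (hd : IsWordDominated g ε (gammaCoeffOfDegree D deg d))
    (hε : 0 < ε) (hlg : IsLogBranch U lg) (hU : U ⊆ smallRegion g ε) {a : ι → ℂ} (ha : a ∈ U)
    {c : ι → ℤ} {s : ℤ} (hc : ∑ v, (c v : A) * D v = 0)
    (hs : ∀ p, deg p = d → ∑ v, c v * p v = s) :
    ∑ v, ((c v : ℂ) * a v) • lineDeriv ℂ (gammaSeries D lg deg d) a (Pi.single v 1) =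
      (s : ℂ) • gammaSeries D lg deg d a := by
  have hderiv := hasSum_sum fun v (_ : v ∈ Finset.univ) =>
    (hasSum_lineDeriv_laurentSeries_mul_expFactor hd hε hlg hU D ha v).const_smul ((c v : ℂ) * a v)
  have hseries := ((hd.summable hε.le (hU ha)).hasSum.mul_right (expFactor lg D a)).const_smul
    (s : ℂ)
  refine hderiv.unique (hseries.congr_fun fun p => ?_)
  by_cases hp : deg p = d
  swap
  · simp [gammaCoeffOfDegree, hp]
  have hweight : ∑ v, (c v : A) * (D v + (p v : A)) = (s : A) := by
    simp only [mul_add, Finset.sum_add_distrib, hc, zero_add, ← hs p hp]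
    push_cast
    rfl
  have hterm : ∀ v, ((c v : ℂ) * a v) • (laurent a (p - Pi.single v 1) •
      ((D v + (p v : A)) * gammaCoeffOfDegree D deg d p) * expFactor lg D a) =
      ((c v : A) * (D v + (p v : A))) *
        (laurent a p • gammaCoeffOfDegree D deg d p * expFactor lg D a) := fun v => by
    have hcancel : algebraMap ℂ A (a v) * algebraMap ℂ A (a v)⁻¹ = 1 := by
      rw [← map_mul, mul_inv_cancel₀ (hlg.ne_zero ha v), map_one]
    simp only [laurent_sub_single (hlg.ne_zero ha), Algebra.smul_def, map_mul, map_intCast]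
    linear_combination ((c v : A) * (D v + (p v : A)) * algebraMap ℂ A (laurent a p) *
      gammaCoeffOfDegree D deg d p * expFactor lg D a) * hcancel
  simp only [hterm, ← Finset.sum_mul, hweight]
  simp [Algebra.smul_def]

end GammaSeries

/-! ### Simplicial complexes all of whose facets contain the origin -/

section StarShaped

open Module Geometry

theorem exists_dual_forall_apply_eq {K V ι : Type*} [Field K] [AddCommGroup V] [Module K V]
    {v : ι → V} (hv : LinearIndependent K v) (c : ι → K) : ∃ f : Dual K V, ∀ i, f (v i) = c i := by
  obtain ⟨g, hg⟩ := (Finsupp.linearCombination K v).exists_leftInverse_of_injective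
    (LinearMap.ker_eq_bot.2 hv)
  refine ⟨Finsupp.linearCombination K c ∘ₗ g, fun i => ?_⟩
  have hi : g (v i) = Finsupp.single i 1 := by
    simpa using LinearMap.congr_fun hg (Finsupp.single i 1)
  simp [hi]

variable {E : Type*} [AddCommGroup E] [Module ℝ E]

theorem exists_dual_add_eq_of_affineIndependent {s : Finset E}
    (hs : AffineIndependent ℝ ((↑) : s → E)) (h0 : 0 ∈ s) (h : E → ℝ) :
    ∃ m : Dual ℝ E, ∀ w ∈ s, m w + h 0 = h w := by
  rw [affineIndependent_iff_linearIndependent_vsub ℝ _ (⟨0, h0⟩ : s)] at hs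
  obtain ⟨m, hm⟩ := exists_dual_forall_apply_eq hs fun w => h w - h 0
  refine ⟨m, fun w hw => ?_⟩
  obtain rfl | hw0 := eq_or_ne w 0
  · simp
  · have hmw := hm ⟨⟨w, hw⟩, fun h => hw0 (congrArg Subtype.val h)⟩
    simp only [vsub_eq_sub, sub_zero] at hmw
    rw [hmw, sub_add_cancel]

theorem exists_pos_sum_smul_eq_of_mem_span {s : Finset E} (hs : s.Nonempty) {x : E}
    (hx : x ∈ Submodule.span ℝ (s : Set E)) :
    ∃ b ∈ convexHull ℝ (s : Set E), ∃ τ ∈ Set.Ioo (0 : ℝ) 1, ∃ α : E → ℝ, (∀ w ∈ s, 0 < α w) ∧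
      ∑ w ∈ s, α w • w = (1 - τ) • b + τ • x := by
  obtain ⟨c, -, rfl⟩ := Submodule.mem_span_finset.1 hx
  have hcard : (0 : ℝ) < s.card := by exact_mod_cast hs.card_pos
  have hpos : ∀ᶠ τ in 𝓝[>] (0 : ℝ), ∀ w ∈ s, 0 < (1 - τ) * (s.card : ℝ)⁻¹ + τ * c w := by
    refine Filter.Eventually.filter_mono nhdsWithin_le_nhds
      ((Finset.eventually_all _).2 fun w _ => ?_)
    have hcont : Continuous fun τ : ℝ => (1 - τ) * (s.card : ℝ)⁻¹ + τ * c w := by fun_prop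
    exact hcont.continuousAt.eventually_const_lt (by simpa using hcard)
  obtain ⟨τ, hα, hτ⟩ := (hpos.and (Ioo_mem_nhdsGT zero_lt_one)).exists
  refine ⟨∑ w ∈ s, (s.card : ℝ)⁻¹ • w, ?_, τ, hτ, fun w => (1 - τ) * (s.card : ℝ)⁻¹ + τ * c w,
    hα, ?_⟩
  · exact (convex_convexHull ℝ _).sum_mem (fun _ _ => by positivity) (by simp [hcard.ne'])
      fun w hw => subset_convexHull ℝ _ hw
  · simp only [add_smul, mul_smul, Finset.sum_add_distrib, Finset.smul_sum]

variable {K : SimplicialComplex ℝ E} {s t : Finset E}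

theorem subset_of_pos_sum_smul_mem_convexHull (hs : s ∈ K.faces) (ht : t ∈ K.faces) {α : E → ℝ}
    (hα : ∀ w ∈ s, 0 < α w) (hα1 : ∑ w ∈ s, α w = 1)
    (hx : ∑ w ∈ s, α w • w ∈ convexHull ℝ (t : Set E)) : s ⊆ t := by
  classical
  have hxs : ∑ w ∈ s, α w • w ∈ convexHull ℝ (s : Set E) :=
    (convex_convexHull ℝ _).sum_mem (fun w hw => (hα w hw).le) hα1
      fun w hw => subset_convexHull ℝ _ hw
  have hst := K.inter_subset_convexHull hs ht ⟨hxs, hx⟩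
  rw [← Finset.coe_inter, Finset.mem_convexHull'] at hst
  obtain ⟨β, -, hβ1, hβ⟩ := hst
  let γ : E → ℝ := fun w => if w ∈ t then β w else 0
  have hαγ := (K.indep hs).eq_of_sum_eq_sum_subtype (w₁ := α) (w₂ := γ)
    (by simp only [γ, ← Finset.sum_filter, Finset.filter_mem_eq_inter, hα1, hβ1])
    (by simp only [γ, ite_smul, zero_smul, ← Finset.sum_filter, Finset.filter_mem_eq_inter, hβ])
  intro w hw
  by_contra hwt
  exact (hα w hw).ne' ((hαγ w hw).trans (if_neg hwt))

/-- Scaling into the interior of the facet keeps the point in `t`, because `t` contains the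
origin. -/
theorem eq_of_pos_sum_erase_smul_mem_convexHull [DecidableEq E] (hs : s ∈ K.facets) (hs0 : 0 ∈ s)
    (ht : t ∈ K.faces) (ht0 : 0 ∈ t) {α : E → ℝ} (hα : ∀ w ∈ s.erase 0, 0 < α w)
    (hx : ∑ w ∈ s.erase 0, α w • w ∈ convexHull ℝ (t : Set E)) : s = t := by
  set σ := ∑ w ∈ s.erase 0, α w
  have hσ : 0 < 1 + σ := by linarith [Finset.sum_nonneg fun w hw => (hα w hw).le]
  let β : E → ℝ := fun w => if w = 0 then (1 + σ)⁻¹ else (1 + σ)⁻¹ * α w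
  have hβ : ∀ w ∈ s.erase 0, β w = (1 + σ)⁻¹ * α w := fun w hw => if_neg (Finset.ne_of_mem_erase hw)
  refine hs.2 ht (subset_of_pos_sum_smul_mem_convexHull hs.1 ht (α := β) (fun w hw => ?_) ?_ ?_)
  · obtain rfl | hw0 := eq_or_ne w 0
    · simpa [β] using hσ
    · rw [hβ w (Finset.mem_erase.2 ⟨hw0, hw⟩)]
      exact mul_pos (inv_pos.2 hσ) (hα w (Finset.mem_erase.2 ⟨hw0, hw⟩))
  · rw [← Finset.add_sum_erase s β hs0, Finset.sum_congr rfl hβ, ← Finset.mul_sum]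
    simp only [β, if_true]
    rw [← mul_one_add, inv_mul_cancel₀ hσ.ne']
  · rw [← Finset.add_sum_erase s _ hs0, smul_zero, zero_add,
      Finset.sum_congr rfl fun w hw => by rw [hβ w hw, mul_smul], ← Finset.smul_sum]
    have hσ1 : 1 ≤ 1 + σ := by linarith [Finset.sum_nonneg fun w hw => (hα w hw).le]
    exact (convex_convexHull ℝ _).smul_mem_of_zero_mem (subset_convexHull ℝ _ ht0) hx
      ⟨(inv_pos.2 hσ).le, inv_le_one_of_one_le₀ hσ1⟩

theorem apply_le_one_of_mem_space (hconv : Convex ℝ K.space)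
    (hstar : ∀ x ∈ K.space, ∃ t ∈ K.faces, 0 ∈ t ∧ x ∈ convexHull ℝ (t : Set E))
    (hs : s ∈ K.facets) (hs0 : 0 ∈ s) {m : Dual ℝ E} (hm : ∀ w ∈ s, w ≠ 0 → m w = 1) {x : E}
    (hx : x ∈ K.space) (hspan : x ∈ Submodule.span ℝ (s : Set E)) : m x ≤ 1 := by
  classical
  by_contra! hlt
  have hm' : ∀ w ∈ s.erase 0, m w = 1 := fun w hw =>
    hm w (Finset.mem_of_mem_erase hw) (Finset.ne_of_mem_erase hw)
  have hspan' : x ∈ Submodule.span ℝ ((s.erase 0 : Finset E) : Set E) := by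
    rwa [Finset.coe_erase, Submodule.span_sdiff_singleton_zero]
  have hne : (s.erase 0).Nonempty := by
    rw [Finset.nonempty_iff_ne_empty]
    intro h
    simp only [h, Finset.coe_empty, Submodule.span_empty, Submodule.mem_bot] at hspan'
    rw [hspan', map_zero] at hlt
    exact zero_lt_one.not_gt hlt
  obtain ⟨b, hb, τ, hτ, α, hα, hsum⟩ := exists_pos_sum_smul_eq_of_mem_span hne hspan'
  have hmb : m b = 1 :=
    convexHull_min (t := {y | m y = 1}) hm' (convex_hyperplane m.isLinear 1) hb
  have hbK : b ∈ K.space := K.convexHull_subset_space hs.1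
    (convexHull_mono (Finset.coe_subset.2 (Finset.erase_subset _ _)) hb)
  obtain ⟨t, ht, ht0, hyt⟩ := hstar _ (hconv hbK hx (sub_nonneg.2 hτ.2.le) hτ.1.le (by ring))
  have hst : s = t := eq_of_pos_sum_erase_smul_mem_convexHull hs hs0 ht ht0 hα (hsum ▸ hyt)
  have hle : ∀ y ∈ convexHull ℝ (t : Set E), m y ≤ 1 := by
    refine convexHull_min (t := {y | m y ≤ 1}) (fun w hw => ?_) (convex_halfSpace_le m.isLinear 1)
    obtain rfl | hw0 := eq_or_ne w 0
    · simp
    · exact (hm w (hst ▸ hw) hw0).le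
  have := hle _ hyt
  simp only [map_add, map_smul, hmb, smul_eq_mul] at this
  nlinarith [hτ.1]

end StarShaped

/-! ### Facets of a regular projective triangulation -/

section Facets

variable {n : ℕ} {P : ReflexivePolytope n}

theorem latt_injective : Function.Injective (latt : (Fin n → ℤ) → Fin n → ℝ) :=
  Int.cast_injective.comp_left

@[simp] theorem latt_zero : latt (0 : Fin n → ℤ) = 0 := by ext; simp [latt]

theorem latt_zsmul (k : ℤ) (v : Fin n → ℤ) : latt (k • v) = k • latt v := by
  ext; simp [latt]

theorem latt_sum {J : Type*} (s : Finset J) (f : J → Fin n → ℤ) :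
    latt (∑ j ∈ s, f j) = ∑ j ∈ s, latt (f j) := by
  ext; simp [latt]

theorem latt_eq_zero {v : Fin n → ℤ} : latt v = 0 ↔ v = 0 := by
  rw [← latt_zero, latt_injective.eq_iff]

theorem latt_dotProduct (x y : Fin n → ℤ) : latt x ⬝ᵥ latt y = ((x ⬝ᵥ y : ℤ) : ℝ) := by
  simp [latt, dotProduct]

namespace ReflexivePolytope

@[simp] theorem origin_val : (P.origin : P.Point).1 = 0 := rfl

theorem convex_carrier (P : ReflexivePolytope n) : Convex ℝ P.carrier := by
  obtain ⟨V, hV⟩ := P.isLatticePolytope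
  exact hV ▸ convex_convexHull ℝ _

end ReflexivePolytope

namespace RegularProjectiveTriangulation

variable {T : RegularProjectiveTriangulation P.carrier} {s : Finset (Fin n → ℝ)}

theorem exists_point_of_mem_face (hs : s ∈ T.complex.faces) {x : Fin n → ℝ} (hx : x ∈ s) :
    ∃ v : P.Point, latt v.1 = x := by
  obtain ⟨v, rfl⟩ := T.vertices_integral x (T.complex.down_closed hs (by simpa using hx) (by simp))
  exact ⟨⟨v, T.space_eq ▸ T.complex.subset_space hs hx⟩, rfl⟩

variable (T) in
theorem finite_faces : T.complex.faces.Finite := by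
  classical
  refine (Finset.finite_toSet (Finset.univ.image fun v : P.Point => latt v.1).powerset).subset
    fun s hs => Finset.mem_coe.2 (Finset.mem_powerset.2 fun x hx => ?_)
  obtain ⟨v, hv⟩ := T.exists_point_of_mem_face hs hx
  exact Finset.mem_image.2 ⟨v, Finset.mem_univ _, hv⟩

theorem exists_facet_of_face (hs : s ∈ T.complex.faces) : ∃ t ∈ T.complex.facets, s ⊆ t := by
  obtain ⟨t, hst, ht⟩ := T.finite_faces.exists_le_maximal hs
  exact ⟨t, ⟨ht.1, fun u hu htu => le_antisymm htu (ht.2 hu htu)⟩, hst⟩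

variable (T) in
theorem exists_facet_of_mem {x : Fin n → ℝ} (hx : x ∈ P.carrier) :
    ∃ t ∈ T.complex.facets, x ∈ convexHull ℝ (t : Set (Fin n → ℝ)) := by
  obtain ⟨s, hs, hxs⟩ := Geometry.SimplicialComplex.mem_space_iff.1 (T.space_eq.symm ▸ hx)
  obtain ⟨t, ht, hst⟩ := T.exists_facet_of_face hs
  exact ⟨t, ht, convexHull_mono (Finset.coe_subset.2 hst) hxs⟩

theorem exists_dotProduct_add_eq (hs : s ∈ T.complex.facets) (h : (Fin n → ℝ) → ℝ) :
    ∃ m : Fin n → ℝ, ∀ w ∈ s, m ⬝ᵥ w + h 0 = h w := by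
  obtain ⟨φ, hφ⟩ := exists_dual_add_eq_of_affineIndependent (T.complex.indep hs.1)
    (T.zero_mem_facets s hs) h
  obtain ⟨m, rfl⟩ := (dotProductEquiv ℝ (Fin n)).surjective φ
  exact ⟨m, hφ⟩

theorem exists_integral_affine_coordinates (hs : s ∈ T.complex.facets) (v : Fin n → ℤ) :
    ∃ c : P.Point → ℤ, (∀ w, latt w.1 ∉ s → c w = 0) ∧ ∑ w, c w = 1 ∧ ∑ w, c w • w.1 = v := by
  classical
  obtain ⟨f, -, hf⟩ := Submodule.mem_span_finset.1 (T.unimodular s hs v)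
  let c₀ : P.Point → ℤ := fun w => if latt w.1 ∈ s then f (latt w.1) else 0
  have hc₀ : ∑ w, c₀ w • w.1 = v := by
    apply latt_injective
    simp only [← hf, latt_sum, latt_zsmul, c₀]
    simp only [ite_smul, zero_smul]
    rw [← Finset.sum_filter]
    refine Finset.sum_nbij (fun w : P.Point => latt w.1) (by simp)
      (fun _ _ _ _ h => Subtype.ext (latt_injective h)) (fun x hx => ?_) fun _ _ => rfl
    obtain ⟨w, rfl⟩ := T.exists_point_of_mem_face hs.1 hx
    exact ⟨w, by simpa using hx, rfl⟩
  refine ⟨c₀ + Pi.single P.origin (1 - ∑ w, c₀ w), fun w hw => ?_, ?_, ?_⟩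
  · have hw0 : w ≠ P.origin := by
      rintro rfl
      exact hw (by simpa using T.zero_mem_facets s hs)
    simp [c₀, hw, hw0]
  · simp [Finset.sum_add_distrib]
  · simp only [Pi.add_apply, add_smul, Finset.sum_add_distrib, hc₀, add_eq_left]
    refine Finset.sum_eq_zero fun w _ => ?_
    obtain rfl | hw := eq_or_ne w P.origin <;> simp [*]

theorem dotProduct_le_one (hs : s ∈ T.complex.facets) {m : Fin n → ℝ}
    (hm : ∀ w ∈ s, w ≠ 0 → m ⬝ᵥ w = 1) (v : P.Point) : m ⬝ᵥ latt v.1 ≤ 1 := by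
  refine apply_le_one_of_mem_space (m := dotProductEquiv ℝ (Fin n) m)
    (T.space_eq.symm ▸ P.convex_carrier) (fun x hx => ?_) hs (T.zero_mem_facets s hs) hm
    (T.space_eq.symm ▸ v.2) (Submodule.span_le_restrictScalars ℤ ℝ _ (T.unimodular s hs v.1))
  obtain ⟨t, ht, hxt⟩ := T.exists_facet_of_mem (T.space_eq ▸ hx)
  exact ⟨t, ht.1, T.zero_mem_facets t ht, hxt⟩

end RegularProjectiveTriangulation

end Facets

/-! ### Finitely generated pointed cones and their lattice points -/

section Cones

theorem exists_wordSum_eq_of_mem_closure {ι κ : Type*} (g : κ → ι → ℤ) {ℓ : ι → ℤ}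
    (hℓ : ℓ ∈ AddSubmonoid.closure (Set.range g)) : ∃ σ, wordSum g σ = ℓ := by
  obtain ⟨l, hl, rfl⟩ := AddSubmonoid.exists_list_of_mem_closure hℓ
  choose k hk using hl
  refine ⟨⟨l.length, fun i => k (l.get i) (l.get_mem i)⟩, ?_⟩
  simp only [wordSum, hk]
  exact Fin.sum_univ_getElem l

open PointedCone

variable {E κ : Type*} [AddCommGroup E] [Module ℝ E]

theorem mem_hull_range_iff [Fintype κ] {r : κ → E} {x : E} :
    x ∈ hull ℝ (Set.range r) ↔ ∃ t : κ → ℝ, (∀ k, 0 ≤ t k) ∧ ∑ k, t k • r k = x := by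
  rw [hull, Submodule.mem_span_range_iff_exists_fun]
  exact ⟨fun ⟨c, hc⟩ => ⟨fun k => c k, fun k => (c k).2, hc⟩,
    fun ⟨t, ht, hx⟩ => ⟨fun k => ⟨t k, ht k⟩, hx⟩⟩

variable [Finite κ]

theorem pos_of_mem_hull_range {r : κ → E} {f : E →ₗ[ℝ] ℝ} (hf : ∀ k, 0 < f (r k)) {x : E}
    (hx : x ∈ hull ℝ (Set.range r)) (hx0 : x ≠ 0) : 0 < f x := by
  have := Fintype.ofFinite κ
  obtain ⟨t, ht, rfl⟩ := mem_hull_range_iff.1 hx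
  obtain ⟨k, -, hk⟩ := Finset.exists_ne_zero_of_sum_ne_zero hx0
  simp only [map_sum, map_smul, smul_eq_mul]
  exact Finset.sum_pos' (fun k _ => mul_nonneg (ht k) (hf k).le)
    ⟨k, Finset.mem_univ k, mul_pos ((ht k).lt_of_ne' (left_ne_zero_of_smul hk)) (hf k)⟩

variable [TopologicalSpace E] [IsTopologicalAddGroup E] [ContinuousSMul ℝ E]

/-- Below each level of `f` the coefficients of a point of the cone are bounded, so that part of
the cone is the image of a compact box. -/
theorem isClosed_hull_range [T2Space E] {r : κ → E} {f : E →L[ℝ] ℝ} (hf : ∀ k, 0 < f (r k)) :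
    IsClosed (hull ℝ (Set.range r) : Set E) := by
  have := Fintype.ofFinite κ
  refine isClosed_of_closure_subset fun y hy => ?_
  let φ : (κ → ℝ) → E := fun t => ∑ k, t k • r k
  let box : Set (κ → ℝ) := Set.Icc 0 fun k => (f y + 1) / f (r k)
  have hclosed : IsClosed (φ '' box) := (isCompact_Icc.image (by fun_prop)).isClosed
  have hsub : {z | f z < f y + 1} ∩ hull ℝ (Set.range r) ⊆ φ '' box := by
    rintro z ⟨hz, hzr⟩
    obtain ⟨t, ht, rfl⟩ := mem_hull_range_iff.1 hzr
    refine ⟨t, ⟨ht, fun k => (le_div_iff₀ (hf k)).2 ?_⟩, rfl⟩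
    simp only [Set.mem_ofPred_eq, map_sum, map_smul, smul_eq_mul] at hz
    exact (Finset.single_le_sum (f := fun k => t k * f (r k))
      (fun k _ => mul_nonneg (ht k) (hf k).le) (Finset.mem_univ k)).trans hz.le
  obtain ⟨t, ht, rfl⟩ := closure_minimal hsub hclosed
    ((isOpen_lt (by fun_prop) continuous_const).inter_closure ⟨lt_add_one (f y), hy⟩)
  exact mem_hull_range_iff.2 ⟨t, ht.1, rfl⟩

theorem mem_hull_range_of_forall_nonneg [T2Space E] [LocallyConvexSpace ℝ E] {r : κ → E}
    {f : E →L[ℝ] ℝ} (hf : ∀ k, 0 < f (r k)) {x : E}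
    (hx : ∀ h : E →L[ℝ] ℝ, (∀ k, 0 ≤ h (r k)) → 0 ≤ h x) : x ∈ hull ℝ (Set.range r) := by
  by_contra hxr
  let C : ProperCone ℝ E := ⟨hull ℝ (Set.range r), isClosed_hull_range hf⟩
  obtain ⟨h, hr, hlt⟩ := C.hyperplane_separation_point hxr
  exact hlt.not_ge (hx h fun k => hr _ (Submodule.subset_span ⟨k, rfl⟩))

/-- Gordan's lemma. Rounding down the coefficients of a point of the cone leaves a lattice point
in the compact box spanned by the generators. -/
theorem fg_comap_hull_range {L : Type*} [AddCommGroup L] {φ : L →+ E}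
    (hφ : Tendsto φ cofinite (cocompact E)) (r : κ → L) :
    ((hull ℝ (Set.range fun k => φ (r k))).toAddSubmonoid.comap φ).FG := by
  classical
  have := Fintype.ofFinite κ
  let box : Set E := (fun t : κ → ℝ => ∑ k, t k • φ (r k)) '' Set.Icc 0 1
  have hbox : (φ ⁻¹' box).Finite := by
    simpa using hφ (isCompact_Icc.image (by fun_prop) : IsCompact box).compl_mem_cocompact
  refine (AddSubmonoid.fg_iff _).2 ⟨φ ⁻¹' box, le_antisymm ?_ fun ℓ hℓ => ?_, hbox⟩
  · rw [AddSubmonoid.closure_le]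
    rintro ℓ ⟨t, ht, hℓ⟩
    exact mem_hull_range_iff.2 ⟨t, ht.1, hℓ⟩
  · obtain ⟨t, ht, hℓt⟩ := mem_hull_range_iff.1 hℓ
    have hr : ∀ k, r k ∈ φ ⁻¹' box := fun k =>
      ⟨Pi.single k 1, ⟨Pi.single_nonneg.2 zero_le_one,
        update_le_iff.2 ⟨le_rfl, fun _ _ => zero_le_one⟩⟩, by simp [Pi.single_apply]⟩
    have hfract : ℓ - ∑ k, ⌊t k⌋₊ • r k ∈ φ ⁻¹' box := by
      refine ⟨fun k => t k - ⌊t k⌋₊, ⟨fun k => sub_nonneg.2 (Nat.floor_le (ht k)), fun k => ?_⟩, ?_⟩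
      · exact (sub_lt_iff_lt_add'.2 (Nat.lt_floor_add_one (t k))).le
      · simp [sub_smul, Finset.sum_sub_distrib, hℓt, Nat.cast_smul_eq_nsmul]
    rw [← sub_add_cancel ℓ (∑ k, ⌊t k⌋₊ • r k)]
    exact add_mem (AddSubmonoid.subset_closure hfract)
      (sum_mem fun k _ => nsmul_mem (AddSubmonoid.subset_closure (hr k)) _)

end Cones

/-! ### The Mori cone -/

section Mori

open PointedCone

section Pairing

variable {ι κ : Type*}

theorem mem_hull_range_iff_forall_dotProduct_nonneg [Fintype ι] [Finite κ] {r : κ → ι → ℝ}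
    {ω₀ : ι → ℝ} (hω₀ : ∀ k, 0 < ω₀ ⬝ᵥ r k) {x : ι → ℝ} : x ∈ hull ℝ (Set.range r) ↔
      ∀ ω : ι → ℝ, (∀ k, 0 ≤ ω ⬝ᵥ r k) → 0 ≤ ω ⬝ᵥ x := by
  classical
  have := Fintype.ofFinite κ
  refine ⟨fun hx ω hω => ?_, fun hx => mem_hull_range_of_forall_nonneg
    (f := (dotProductEquiv ℝ ι ω₀).toContinuousLinearMap) hω₀ fun h hh => ?_⟩
  · obtain ⟨t, ht, rfl⟩ := mem_hull_range_iff.1 hx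
    simp only [dotProduct_sum, dotProduct_smul, smul_eq_mul]
    exact Finset.sum_nonneg fun k _ => mul_nonneg (ht k) (hω k)
  · obtain ⟨ω, hω⟩ := (dotProductEquiv ℝ ι).surjective h.toLinearMap
    have hωh : ∀ y, ω ⬝ᵥ y = h y := LinearMap.congr_fun hω
    simp only [← hωh] at hh ⊢
    exact hx ω hh

theorem tendsto_intCast_comp_cofinite [Finite ι] :
    Tendsto (fun (p : ι → ℤ) i => (p i : ℝ)) cofinite (cocompact (ι → ℝ)) := by
  rw [← coprodᵢ_cofinite, ← coprodᵢ_cocompact]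
  exact Tendsto.pi_map_coprodᵢ fun _ => Int.tendsto_coe_cofinite

theorem smallRegion_nonempty [Fintype ι] [Finite κ] {g : κ → ι → ℤ} {ω : ι → ℝ}
    (hω : ∀ k, 0 < ∑ v, ω v * (g k v : ℝ)) {ε : ℝ} (hε : 0 < ε) :
    (smallRegion g ε).Nonempty := by
  have hlim : ∀ k, Tendsto (fun c : ℝ => Real.exp (-(c * ∑ v, ω v * (g k v : ℝ)))) atTop (𝓝 0) :=
    fun k => Real.tendsto_exp_neg_atTop_nhds_zero.comp (tendsto_id.atTop_mul_const (hω k))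
  obtain ⟨c, hc⟩ := (eventually_all.2 fun k => (hlim k).eventually_lt_const hε).exists
  refine ⟨fun v => (Real.exp (-(c * ω v)) : ℝ), fun v => by simp [Complex.exp_ne_zero],
    fun k => lt_of_eq_of_lt ?_ (hc k)⟩
  rw [laurent, norm_prod, Finset.mul_sum, ← Finset.sum_neg_distrib, Real.exp_sum]
  refine Finset.prod_congr rfl fun v _ => ?_
  rw [norm_zpow, Complex.norm_of_nonneg (Real.exp_pos _).le, ← Real.rpow_intCast, ← Real.exp_mul]
  ring_nf

end Pairing

variable {n : ℕ} {P : ReflexivePolytope n}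

/-- The degree `(∑ p_v v, ∑ p_v)` of an exponent for the torus action and the scaling of the
GKZ-system. -/
def expDegree (P : ReflexivePolytope n) : (P.Point → ℤ) →+ (Fin n → ℤ) × ℤ where
  toFun p := (∑ v, p v • v.1, ∑ v, p v)
  map_zero' := by simp
  map_add' p q := by simp [add_smul, Finset.sum_add_distrib]

theorem expDegree_single (v : P.Point) : expDegree P (Pi.single v 1) = (v.1, 1) := by
  ext <;> simp [expDegree, Pi.single_apply]

theorem mem_relations_iff {ℓ : P.Point → ℤ} : ℓ ∈ P.relations ↔ expDegree P ℓ = 0 := by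
  rw [Prod.ext_iff]
  rfl

theorem sum_dotProduct_add_mul (p : P.Point → ℤ) (m : Fin n → ℝ) (c : ℝ) :
    ∑ v : P.Point, (m ⬝ᵥ latt v.1 + c) * (p v : ℝ) =
      m ⬝ᵥ latt (expDegree P p).1 + c * (expDegree P p).2 := by
  change _ = m ⬝ᵥ latt (∑ v, p v • v.1) + c * (∑ v, p v : ℤ)
  simp only [latt_sum, latt_zsmul, dotProduct_sum, ← Int.cast_smul_eq_zsmul ℝ, dotProduct_smul,
    smul_eq_mul, Int.cast_sum, Finset.mul_sum, ← Finset.sum_add_distrib]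
  exact Finset.sum_congr rfl fun v _ => by ring

theorem sum_dotProduct_add_mul_of_mem_relations {ℓ : P.Point → ℤ} (hℓ : ℓ ∈ P.relations)
    (m : Fin n → ℝ) (c : ℝ) : ∑ v : P.Point, (m ⬝ᵥ latt v.1 + c) * (ℓ v : ℝ) = 0 := by
  simp [sum_dotProduct_add_mul, mem_relations_iff.1 hℓ]

variable {T : RegularProjectiveTriangulation P.carrier} {s : Finset (Fin n → ℝ)}

theorem exists_relation_of_facet (hs : s ∈ T.complex.facets) (v : P.Point) :
    ∃ r ∈ P.relations, ∀ (ω : P.Point → ℝ) (m : Fin n → ℝ) (c : ℝ),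
      (∀ w : P.Point, latt w.1 ∈ s → m ⬝ᵥ latt w.1 + c = ω w) →
        ∑ w, ω w * (r w : ℝ) = ω v - (m ⬝ᵥ latt v.1 + c) := by
  obtain ⟨q, hqs, hq1, hqv⟩ := T.exists_integral_affine_coordinates hs v.1
  have hq : expDegree P q = (v.1, 1) := Prod.ext hqv hq1
  refine ⟨Pi.single v 1 - q, ?_, fun ω m c h => ?_⟩
  · rw [mem_relations_iff, map_sub, expDegree_single, hq, sub_self]
  · have hωq : ∑ w, ω w * (q w : ℝ) = m ⬝ᵥ latt v.1 + c := by
      have hsum := sum_dotProduct_add_mul q m c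
      simp only [hq, Int.cast_one, mul_one] at hsum
      refine hsum ▸ Finset.sum_congr rfl fun w _ => ?_
      by_cases hw : latt w.1 ∈ s
      · rw [h w hw]
      · simp [hqs w hw]
    simp [mul_sub, Finset.sum_sub_distrib, hωq, Pi.single_apply]

theorem exists_affine_eq_on_facet (hs : s ∈ T.complex.facets) (ω : P.Point → ℝ) :
    ∃ (m : Fin n → ℝ) (c : ℝ), ∀ w : P.Point, latt w.1 ∈ s → m ⬝ᵥ latt w.1 + c = ω w := by
  have hinj : Function.Injective fun w : P.Point => latt w.1 :=
    latt_injective.comp Subtype.val_injective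
  obtain ⟨m, hm⟩ := T.exists_dotProduct_add_eq hs
    (Function.extend (fun w : P.Point => latt w.1) ω 0)
  exact ⟨m, _, fun w hw => (hm _ hw).trans (hinj.extend_apply ω 0 w)⟩

variable (T) in
theorem exists_relations_kaehlerCone : ∃ (κ : Type) (_ : Fintype κ) (r : κ → P.Point → ℤ),
    (∀ k, r k ∈ P.relations) ∧
    (∀ ω, ω ∈ kaehlerCone T ↔ ∀ k, 0 ≤ ∑ v, ω v * (r k v : ℝ)) ∧
    ∃ ω₀ : P.Point → ℝ, ∀ k, 0 < ∑ v, ω₀ v * (r k v : ℝ) := by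
  have : Finite T.complex.facets := T.finite_faces.subset fun s hs => hs.1
  choose r hrL hr using fun k : T.complex.facets × P.Point => exists_relation_of_facet k.1.2 k.2
  refine ⟨{k : T.complex.facets × P.Point // latt k.2.1 ∉ k.1.1}, Fintype.ofFinite _,
    fun k => r k.1, fun k => hrL k.1, fun ω => ⟨fun hω k => ?_, fun hω s hs => ?_⟩, ?_⟩
  · obtain ⟨m, c, heq, hle⟩ := hω k.1.1.1 k.1.1.2
    rw [hr k.1 ω m c heq]
    exact sub_nonneg.2 (hle _)
  · obtain ⟨m, c, heq⟩ := exists_affine_eq_on_facet hs ω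
    refine ⟨m, c, heq, fun v => ?_⟩
    by_cases hv : latt v.1 ∈ s
    · exact (heq v hv).le
    · exact sub_nonneg.1 (hr (⟨s, hs⟩, v) ω m c heq ▸ hω ⟨(⟨s, hs⟩, v), hv⟩)
  · obtain ⟨ω, hω⟩ := T.projective
    refine ⟨fun v => ω v.1, fun k => ?_⟩
    obtain ⟨m, c, heq, hlt⟩ := hω k.1.1.1 k.1.1.2
    rw [hr k.1 (fun v => ω v.1) m c fun w hw => heq _ hw]
    exact sub_pos.2 (hlt _ k.1.2.2 k.2)

/-- The vectors `g k` generate the monoid `M` of Mori points and lie in an open half space. -/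
structure IsMoriGenerators {κ : Type*} (T : RegularProjectiveTriangulation P.carrier)
    (g : κ → P.Point → ℤ) : Prop where
  mem : ∀ k, g k ∈ moriPoints T
  exists_wordSum : ∀ ℓ ∈ moriPoints T, ∃ σ, wordSum g σ = ℓ
  exists_pos : ∃ ω : P.Point → ℝ, ∀ k, 0 < ∑ v, ω v * (g k v : ℝ)

variable (T) in
theorem exists_isMoriGenerators :
    ∃ (κ : Type) (_ : Fintype κ) (g : κ → P.Point → ℤ), IsMoriGenerators T g := by
  classical
  obtain ⟨κ, _, r, hrL, hr, ω₀, hω₀⟩ := exists_relations_kaehlerCone T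
  let φ : (expDegree P).ker →+ (P.Point → ℝ) :=
    ((Int.castAddHom ℝ).compLeft P.Point).comp (expDegree P).ker.subtype
  have hφ : Tendsto φ cofinite (cocompact _) :=
    tendsto_intCast_comp_cofinite.comp Subtype.val_injective.tendsto_cofinite
  let rL : κ → (expDegree P).ker := fun k => ⟨r k, mem_relations_iff.1 (hrL k)⟩
  have hM : ∀ ℓ : (expDegree P).ker, ℓ.1 ∈ moriPoints T ↔
      φ ℓ ∈ hull ℝ (Set.range fun k => φ (rL k)) := fun ℓ =>
    (and_iff_right (mem_relations_iff.2 ℓ.2)).trans <|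
      (forall_congr' fun ω => imp_congr_left (hr ω)).trans
        (mem_hull_range_iff_forall_dotProduct_nonneg (r := fun k => φ (rL k)) hω₀).symm
  obtain ⟨G, hG⟩ := fg_comap_hull_range hφ rL
  have hGM : ∀ ℓ ∈ G, ℓ.1 ∈ moriPoints T := fun ℓ hℓ =>
    (hM ℓ).2 (hG.le (AddSubmonoid.subset_closure hℓ))
  refine ⟨{ℓ // ℓ ∈ G.erase 0}, inferInstance, fun k => k.1.1,
    fun k => hGM _ (Finset.mem_of_mem_erase k.2), fun ℓ hℓ => ?_, ω₀, fun k => ?_⟩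
  · have hℓG : (⟨ℓ, mem_relations_iff.1 hℓ.1⟩ : (expDegree P).ker) ∈
        AddSubmonoid.closure ((G.erase 0 : Finset _) : Set (expDegree P).ker) := by
      rw [Finset.coe_erase, AddSubmonoid.closure_sdiff_singleton_zero, hG]
      exact (hM _).1 hℓ
    have hmap := AddSubmonoid.mem_map_of_mem (expDegree P).ker.subtype hℓG
    rw [AddMonoidHom.map_mclosure, Set.image_eq_range] at hmap
    exact exists_wordSum_eq_of_mem_closure _ hmap
  · have hφ0 : φ k.1 ≠ 0 := fun h => Finset.ne_of_mem_erase k.2 <|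
      Subtype.ext <| funext fun v => Int.cast_eq_zero.1 (congrFun h v)
    exact pos_of_mem_hull_range (f := dotProductEquiv ℝ P.Point ω₀) hω₀
      ((hM _).1 (hGM _ (Finset.mem_of_mem_erase k.2))) hφ0

variable {κ : Type*} {g : κ → P.Point → ℤ}

theorem IsMoriGenerators.nearLCSL_eq (hg : IsMoriGenerators T g) {ε : ℝ} (hε : ε ≤ 1) :
    nearLCSL T ε = smallRegion g ε := by
  have hne : ∀ k, g k ≠ 0 := fun k h => by
    obtain ⟨ω, hω⟩ := hg.exists_pos
    simpa [h] using hω k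
  ext a
  refine ⟨fun ha => ⟨ha.1, fun k => ha.2 _ (hg.mem k) (hne k)⟩, fun ha => ⟨ha.1, ?_⟩⟩
  intro ℓ hℓ hℓ0
  obtain ⟨⟨N, σ⟩, rfl⟩ := hg.exists_wordSum ℓ hℓ
  change ‖laurent a _‖ < ε
  rw [laurent_wordSum ha.1]
  cases N with
  | zero => exact (hℓ0 (by simp [wordSum])).elim
  | succ N =>
    simp only [Fin.prod_univ_succ, norm_mul, norm_prod]
    exact (mul_le_of_le_one_right (norm_nonneg _) (Finset.prod_le_one (fun _ _ => norm_nonneg _)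
      fun k _ => (ha.2 _).le.trans hε)).trans_lt (ha.2 (σ 0))

theorem mem_moriPoints_of_nonneg_off_facet (hs : s ∈ T.complex.facets) {ℓ : P.Point → ℤ}
    (hℓ : ℓ ∈ P.relations) (hpos : ∀ v, latt v.1 ∉ s → 0 ≤ ℓ v) : ℓ ∈ moriPoints T := by
  refine ⟨hℓ, fun ω hω => ?_⟩
  obtain ⟨m, c, heq, hle⟩ := hω s hs
  rw [← sum_dotProduct_add_mul_of_mem_relations hℓ m c]
  refine Finset.sum_le_sum fun v _ => ?_
  by_cases hv : latt v.1 ∈ s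
  · rw [heq v hv]
  · exact mul_le_mul_of_nonneg_right (hle v) (Int.cast_nonneg (hpos v hv))

theorem neg_single_origin_mem_kaehlerCone :
    (Pi.single P.origin (-1) : P.Point → ℝ) ∈ kaehlerCone T := by
  classical
  intro s hs
  obtain ⟨m, hm⟩ := T.exists_dotProduct_add_eq hs (Pi.single 0 (-1))
  rw [Pi.single_eq_same] at hm
  have hne : ∀ v : P.Point, v ≠ P.origin → latt v.1 ≠ 0 := fun v hv h =>
    hv (Subtype.ext (latt_eq_zero.1 h))
  refine ⟨m, -1, fun v hv => ?_, fun v => ?_⟩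
  · obtain rfl | hv0 := eq_or_ne v P.origin
    · simp
    · rw [hm _ hv, Pi.single_eq_of_ne (hne v hv0), Pi.single_eq_of_ne hv0]
  · obtain rfl | hv0 := eq_or_ne v P.origin
    · simp
    · have hle := T.dotProduct_le_one hs (m := m) (fun w hw hw0 => by
        linarith [hm w hw, Pi.single_eq_of_ne (M := fun _ => ℝ) hw0 (-1)]) v
      rw [Pi.single_eq_of_ne hv0]
      linarith

theorem moriPoints_origin_nonpos {ℓ : P.Point → ℤ} (hℓ : ℓ ∈ moriPoints T) :
    ℓ P.origin ≤ 0 := by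
  have h := hℓ.2 _ neg_single_origin_mem_kaehlerCone
  simpa [Pi.single_apply] using h

end Mori

/-! ### The cohomology ring -/

section NormedAlgebra

theorem exists_normedCommRing_algEquiv (R : Type*) [CommRing R] [Algebra ℂ R]
    [Module.Finite ℂ R] : ∃ (A : Type) (_ : NormedCommRing A) (_ : NormedAlgebra ℂ A),
      FiniteDimensional ℂ A ∧ Nonempty (R ≃ₐ[ℂ] A) := by
  -- `R` acts faithfully on `ℂ ^ r` through multiplication.
  let V := Fin (Module.finrank ℂ R) → ℂ
  let e : R ≃ₗ[ℂ] V := (Module.finBasis ℂ R).equivFun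
  let ρ : R →ₐ[ℂ] (V →L[ℂ] V) :=
    ((Module.End.toContinuousLinearMap V).toAlgHom.comp
      (e.conjAlgEquiv ℂ).toAlgHom).comp (Algebra.lmul ℂ R)
  have hρ : Function.Injective ρ := ((Module.End.toContinuousLinearMap V).injective.comp
    (e.conjAlgEquiv ℂ).injective).comp Algebra.lmul_injective
  let E := AlgEquiv.ofInjective ρ hρ
  refine ⟨ρ.range, { (inferInstance : NormedRing ρ.range) with
    mul_comm := fun x y => ?_ }, (inferInstance : NormedAlgebra ℂ ρ.range),
    Module.Finite.equiv E.toLinearEquiv, ⟨E⟩⟩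
  obtain ⟨x, rfl⟩ := E.surjective x
  obtain ⟨y, rfl⟩ := E.surjective y
  rw [← map_mul, ← map_mul, mul_comm]

theorem map_isNilpotentExp {R A : Type*} [CommRing R] [Algebra ℂ R] [Algebra ℚ R]
    [NormedCommRing A] [NormedAlgebra ℂ A] (φ : R →ₐ[ℂ] A) {x : R} (hx : IsNilpotent x) :
    φ (IsNilpotent.exp x) = NormedSpace.exp (φ x) := by
  obtain ⟨N, hN⟩ := hx
  rw [IsNilpotent.exp_eq_sum hN, NormedSpace.exp_eq_tsum ℂ, map_sum]
  refine ((tsum_eq_sum fun i hi => ?_).trans (Finset.sum_congr rfl fun i _ => ?_)).symm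
  · rw [← map_pow, pow_eq_zero_of_le (by simpa using hi) hN, map_zero, smul_zero]
  · rw [map_inv_natCast_smul φ ℚ ℂ, map_pow]

end NormedAlgebra

section Cohomology

variable {n : ℕ} {P : ReflexivePolytope n} {T : RegularProjectiveTriangulation P.carrier}

variable (T) in
/-- The projection of the polynomial ring onto the cohomology ring which presents it. -/
def toCohomology : MvPolynomial P.Point ℂ →ₐ[ℂ] CohomologyRing T :=
  Ideal.Quotient.mkₐ ℂ (cohomologyIdeal T)

theorem toCohomology_surjective : Function.Surjective (toCohomology T) :=
  Ideal.Quotient.mkₐ_surjective ℂ (cohomologyIdeal T)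

theorem toCohomology_X (v : P.Point) : toCohomology T (MvPolynomial.X v) = divisor T v := rfl

theorem toCohomology_eq_zero {q : MvPolynomial P.Point ℂ} (hq : q ∈ cohomologyIdeal T) :
    toCohomology T q = 0 :=
  Ideal.Quotient.eq_zero_iff_mem.2 hq

theorem sum_divisor : ∑ v, divisor T v = 0 := by
  have h := toCohomology_eq_zero (T := T) (Ideal.subset_span (Or.inl (Or.inl rfl)))
  simpa only [map_sum, toCohomology_X] using h

theorem sum_coord_smul_divisor (j : Fin n) :
    ∑ v : P.Point, ((v.1 j : ℤ) : ℂ) • divisor T v = 0 := by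
  have h := toCohomology_eq_zero (T := T) (Ideal.subset_span (Or.inl (Or.inr ⟨j, rfl⟩)))
  simpa only [map_sum, ← MvPolynomial.smul_eq_C_mul, map_smul, toCohomology_X] using h

theorem sum_dotProduct_add_smul_divisor (m : Fin n → ℝ) (c : ℝ) :
    ∑ v : P.Point, ((m ⬝ᵥ latt v.1 + c : ℝ) : ℂ) • divisor T v = 0 := by
  simp only [dotProduct, latt, Complex.ofReal_add, Complex.ofReal_sum, Complex.ofReal_mul,
    Complex.ofReal_intCast, add_smul, Finset.sum_smul, mul_smul, Finset.sum_add_distrib,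
    ← Finset.smul_sum, sum_divisor, smul_zero, add_zero]
  rw [Finset.sum_comm]
  simp only [← Finset.smul_sum, sum_coord_smul_divisor, smul_zero, Finset.sum_const_zero]

theorem exists_facet_of_prod_divisor_ne_zero {S : Finset P.Point} (h0 : P.origin ∉ S)
    (hS : ∏ v ∈ S, divisor T v ≠ 0) : ∃ t ∈ T.complex.facets, ∀ v ∈ S, latt v.1 ∈ t := by
  obtain rfl | hne := S.eq_empty_or_nonempty
  · obtain ⟨t, ht, -⟩ := T.exists_facet_of_mem P.origin.2
    exact ⟨t, ht, by simp⟩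
  obtain ⟨s, hs, hsS⟩ : ∃ s ∈ T.complex.faces,
      (s : Set (Fin n → ℝ)) = (fun v : P.Point => latt v.1) '' (S : Set P.Point) := by
    by_contra! h
    have hzero := toCohomology_eq_zero (Ideal.subset_span (Or.inr ⟨S, hne, h0, h, rfl⟩))
    rw [map_prod] at hzero
    exact hS hzero
  obtain ⟨t, ht, hst⟩ := T.exists_facet_of_face hs
  exact ⟨t, ht, fun v hv => hst (Finset.mem_coe.1 (hsS ▸ Set.mem_image_of_mem _ hv))⟩

theorem isNilpotent_divisor (v : P.Point) : IsNilpotent (divisor T v) := by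
  classical
  refine nilpotent_iff_mem_prime.2 fun J hJ => ?_
  let S : Finset P.Point := {w | w ≠ P.origin ∧ divisor T w ∉ J}
  have hS : ∏ w ∈ S, divisor T w ≠ 0 := fun h => by
    obtain ⟨w, hw, hwJ⟩ := hJ.prod_mem_iff.1 (h ▸ J.zero_mem : ∏ w ∈ S, divisor T w ∈ J)
    exact (Finset.mem_filter.1 hw).2.2 hwJ
  obtain ⟨t, ht, hSt⟩ := exists_facet_of_prod_divisor_ne_zero (by simp [S]) hS
  have hoff : ∀ w : P.Point, latt w.1 ∉ t → divisor T w ∈ J := fun w hw => by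
    by_contra hwJ
    have hw0 : w ≠ P.origin := by
      rintro rfl
      exact hw (by simpa using T.zero_mem_facets t ht)
    exact hw (hSt w (Finset.mem_filter.2 ⟨Finset.mem_univ _, hw0, hwJ⟩))
  by_cases hv : latt v.1 ∈ t
  swap
  · exact hoff v hv
  -- The affine function with value `1` at `v` and `0` at the other vertices of `t` expresses `D_v`
  -- through the classes off `t`.
  obtain ⟨m, c, hm⟩ := exists_affine_eq_on_facet ht (Pi.single v 1)
  have hsum := sum_dotProduct_add_smul_divisor (T := T) m c
  rw [← Finset.add_sum_erase _ _ (Finset.mem_univ v), hm v hv, Pi.single_eq_same,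
    Complex.ofReal_one, one_smul] at hsum
  rw [eq_neg_of_add_eq_zero_left hsum]
  refine J.neg_mem (J.sum_mem fun w hw => ?_)
  by_cases hwt : latt w.1 ∈ t
  · simp [hm w hwt, Pi.single_eq_of_ne (Finset.ne_of_mem_erase hw)]
  · rw [Algebra.smul_def]
    exact J.mul_mem_left _ (hoff w hwt)

variable (T) in
theorem finite_cohomologyRing : Module.Finite ℂ (CohomologyRing T) := by
  have hgen : Algebra.adjoin ℂ (Set.range (divisor T)) = ⊤ := by
    have hrange : Set.range (divisor T) = toCohomology T '' Set.range MvPolynomial.X := by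
      rw [← Set.range_comp]
      rfl
    rw [hrange, ← AlgHom.map_adjoin, MvPolynomial.adjoin_range_X, Algebra.map_top]
    exact (AlgHom.range_eq_top _).2 toCohomology_surjective
  have hfg := fg_adjoin_of_finite (R := ℂ) (Set.finite_range (divisor T)) (by
    rintro _ ⟨v, rfl⟩
    obtain ⟨N, hN⟩ := isNilpotent_divisor (T := T) v
    exact ⟨Polynomial.X ^ N, Polynomial.monic_X_pow N, by simp [hN]⟩)
  rw [hgen] at hfg
  exact ⟨by simpa using hfg⟩

theorem add_mem_moriPoints_of_gammaCoeff_ne_zero {p m : P.Point → ℤ} (hm : 0 ≤ m)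
    (hp : gammaCoeff (divisor T) p ≠ 0) (hrel : p + m ∈ P.relations) : p + m ∈ moriPoints T := by
  classical
  let S : Finset P.Point := {v | v ≠ P.origin ∧ p v < 0}
  have hS : ∏ v ∈ S, divisor T v ≠ 0 := fun h => hp (zero_dvd_iff.1 (h ▸
    prod_dvd_gammaCoeff _ _ fun v hv => (Finset.mem_filter.1 hv).2.2))
  obtain ⟨t, ht, hSt⟩ := exists_facet_of_prod_divisor_ne_zero (by simp [S]) hS
  refine mem_moriPoints_of_nonneg_off_facet ht hrel fun v hv => add_nonneg ?_ (hm v)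
  by_contra! hpv
  have hv0 : v ≠ P.origin := by
    rintro rfl
    exact hv (by simpa using T.zero_mem_facets t ht)
  exact hv (hSt v (Finset.mem_filter.2 ⟨Finset.mem_univ _, hv0, hpv⟩))

theorem coeffO_eq_gammaCoeff {ℓ : P.Point → ℤ} (hℓ : ℓ P.origin ≤ 0) :
    coeffO T ℓ = gammaCoeff (divisor T - Pi.single P.origin 1) ℓ := by
  have hne : ∀ v ∈ univ.erase P.origin,
      gammaFactor ((divisor T - Pi.single P.origin 1 : P.Point → CohomologyRing T) v) (ℓ v) =
        gammaFactor (divisor T v) (ℓ v) := fun v hv => by simp [Finset.ne_of_mem_erase hv]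
  have hinv := map_prod (MonoidWithZero.inverse : CohomologyRing T →*₀ CohomologyRing T)
    (fun v => ∏ k ∈ range (ℓ v).toNat, (divisor T v + ((k + 1 : ℕ) : CohomologyRing T)))
    (univ.erase P.origin)
  rw [gammaCoeff, ← Finset.prod_erase_mul _ _ (Finset.mem_univ P.origin),
    Finset.prod_congr rfl hne, gammaFactor_of_nonpos _ hℓ]
  simp only [gammaFactor, Finset.prod_mul_distrib]
  rw [coeffO]
  congr 1
  · exact congrArg _ hinv
  · refine Finset.prod_congr rfl fun k _ => ?_
    simp only [Pi.sub_apply, Pi.single_eq_same]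
    push_cast
    ring

theorem coeffO_mul_divisor_origin {ℓ : P.Point → ℤ} (hℓ : ℓ P.origin ≤ 0) :
    coeffO T ℓ * divisor T P.origin = gammaCoeff (divisor T) (ℓ - Pi.single P.origin 1) := by
  rw [coeffO_eq_gammaCoeff hℓ]
  exact gammaCoeff_sub_single_mul (divisor T) hℓ

end Cohomology

/-! ### Families of contiguous functions -/

section Family

variable {n : ℕ} {P : ReflexivePolytope n}

/-- The opposites of the degrees `∑ m_v (v, 1)`, `m_v ≥ 0`: the degrees `d` such that the Laurent
monomials of degree `d` become monomials of degree `0` on multiplication by a suitable `a ^ m`. -/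
def negDegrees (P : ReflexivePolytope n) : Set ((Fin n → ℤ) × ℤ) :=
  {d | ∃ m : P.Point → ℤ, 0 ≤ m ∧ expDegree P m = -d}

theorem sub_expDegree_mem_negDegrees {d : (Fin n → ℤ) × ℤ} (hd : d ∈ negDegrees P)
    {m : P.Point → ℤ} (hm : 0 ≤ m) : d - expDegree P m ∈ negDegrees P := by
  obtain ⟨q, hq, hqd⟩ := hd
  exact ⟨q + m, add_nonneg hq hm, by rw [map_add, hqd]; abel⟩

theorem neg_point_mem_negDegrees (v : P.Point) : (-v.1, -1) ∈ negDegrees P :=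
  ⟨Pi.single v 1, Pi.single_nonneg.2 zero_le_one, by simp [expDegree_single]⟩

theorem zero_neg_one_mem_negDegrees : (0, -1) ∈ negDegrees P := by
  simpa using neg_point_mem_negDegrees P.origin

theorem partialD_congr {U : Set (P.Point → ℂ)} (hU : IsOpen U) {f h : (P.Point → ℂ) → ℂ}
    (hf : Set.EqOn f h U) (v : P.Point) : Set.EqOn (partialD v f) (partialD v h) U := fun _ ha =>
  (hf.eventuallyEq_of_mem (hU.mem_nhds ha)).lineDeriv_eq

/-- A family of functions indexed by degrees in which `∂/∂a_v` lowers the degree by `(v, 1)`, each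
member being quasihomogeneous of its degree (compare the better behaved GKZ systems of Borisov and
Horja). For integral `u` and `k`, the Euler operator of the weight `⟨·, u⟩ + k` on `𝒜` is the
combination of the usual Euler operators with coefficients `u_j` and `k`. -/
structure IsGKZFamily (U : Set (P.Point → ℂ))
    (h : (Fin n → ℤ) × ℤ → (P.Point → ℂ) → ℂ) : Prop where
  isOpen : IsOpen U
  analytic : ∀ d ∈ negDegrees P, AnalyticOnNhd ℂ (h d) U
  partialD_eq : ∀ d ∈ negDegrees P, ∀ v, Set.EqOn (partialD v (h d)) (h (d - (v.1, 1))) U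
  euler : ∀ d ∈ negDegrees P, ∀ (u : Fin n → ℤ) (k : ℤ), ∀ a ∈ U,
    ∑ v : P.Point, ((v.1 ⬝ᵥ u + k : ℤ) : ℂ) * a v * partialD v (h d) a =
      ((d.1 ⬝ᵥ u + k * d.2 : ℤ) : ℂ) * h d a

namespace IsGKZFamily

variable {U : Set (P.Point → ℂ)} {h : (Fin n → ℤ) × ℤ → (P.Point → ℂ) → ℂ}
  {d : (Fin n → ℤ) × ℤ} {f : (P.Point → ℂ) → ℂ}

theorem iterate_partialD_eqOn (hh : IsGKZFamily U h) (hd : d ∈ negDegrees P)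
    (hf : Set.EqOn f (h d) U) (v : P.Point) (k : ℕ) :
    Set.EqOn ((partialD v)^[k] f) (h (d - expDegree P (Pi.single v (k : ℤ)))) U := by
  induction k with
  | zero => simpa using hf
  | succ k ih =>
    have hdeg : d - expDegree P (Pi.single v ((k + 1 : ℕ) : ℤ)) =
        d - expDegree P (Pi.single v (k : ℤ)) - (v.1, 1) := by
      rw [← expDegree_single, sub_sub, ← map_add, ← Pi.single_add, Nat.cast_succ]
    rw [Function.iterate_succ_apply', hdeg]
    exact (partialD_congr hh.isOpen ih v).trans
      (hh.partialD_eq _ (sub_expDegree_mem_negDegrees hd (Pi.single_nonneg.2 k.cast_nonneg)) v)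

theorem mixedD_eqOn (hh : IsGKZFamily U h) (hd : d ∈ negDegrees P)
    (hf : Set.EqOn f (h d) U) (m : P.Point → ℕ) :
    Set.EqOn (mixedD m f) (h (d - expDegree P fun v => (m v : ℤ))) U := by
  have hlist : ∀ l : List P.Point,
      Set.EqOn (l.foldr (fun v g => (partialD v)^[m v] g) f)
        (h (d - expDegree P (l.map fun v => Pi.single v (m v : ℤ)).sum)) U := fun l => by
    induction l with
    | nil => simpa using hf
    | cons v l ih =>
      have hm : 0 ≤ (l.map fun v => Pi.single v (m v : ℤ)).sum := List.sum_nonneg fun p hp => by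
        obtain ⟨w, -, rfl⟩ := List.mem_map.1 hp
        exact Pi.single_nonneg.2 (m w).cast_nonneg
      rw [List.map_cons, List.sum_cons, map_add, add_comm, ← sub_sub]
      exact hh.iterate_partialD_eqOn (sub_expDegree_mem_negDegrees hd hm) ih v (m v)
  have huniv := hlist Finset.univ.toList
  rwa [Finset.sum_map_toList, Finset.univ_sum_single] at huniv

theorem sum_weight_mul_partialD (hh : IsGKZFamily U h) (hd : d ∈ negDegrees P)
    (hf : Set.EqOn f (h d) U) (u : Fin n → ℤ) (k : ℤ) {a : P.Point → ℂ} (ha : a ∈ U) :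
    ∑ v : P.Point, ((v.1 ⬝ᵥ u + k : ℤ) : ℂ) * a v * partialD v f a =
      ((d.1 ⬝ᵥ u + k * d.2 : ℤ) : ℂ) * f a := by
  simp only [partialD_congr hh.isOpen hf _ ha, hf ha]
  exact hh.euler d hd u k a ha

theorem isGKZSolution (hh : IsGKZFamily U h) (hf : Set.EqOn f (h (0, -1)) U) :
    IsGKZSolution U f where
  analytic := (hh.analytic _ zero_neg_one_mem_negDegrees).congr hh.isOpen hf.symm
  box ℓ hℓ a ha := by
    have hdeg : expDegree P (fun v => ((ℓ v).toNat : ℤ)) =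
        expDegree P fun v => ((-ℓ v).toNat : ℤ) := by
      rw [← sub_eq_zero, ← map_sub, ← mem_relations_iff]
      convert hℓ using 1
      exact funext fun v => Int.toNat_sub_toNat_neg (ℓ v)
    have hmixed := fun m => hh.mixedD_eqOn zero_neg_one_mem_negDegrees hf m ha
    rw [hmixed, hmixed, hdeg, sub_self]
  torus j a ha := by
    simpa using hh.sum_weight_mul_partialD zero_neg_one_mem_negDegrees hf (Pi.single j 1) 0 ha
  euler a ha := by
    have heuler := hh.sum_weight_mul_partialD zero_neg_one_mem_negDegrees hf 0 1 ha
    simp only [dotProduct_zero, zero_add, Int.cast_one, one_mul, Int.cast_neg] at heuler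
    rw [heuler]
    ring

/-- The derivatives in `£_v f` have degree `(0, -1) - (v' + v, 1) = (-v, -1) - (v', 1)`, so that
`£_v f` is the Euler operator of the weight `⟨·, u⟩ + 1` applied to the function of degree
`(-v, -1)`, where its eigenvalue is `-⟨v, u⟩ - 1 = 0`. -/
theorem rootOperator_eq_zero (hh : IsGKZFamily U h) (hf : Set.EqOn f (h (0, -1)) U)
    {T' : RegularProjectiveTriangulation (polarDual P.carrier)} {v u : Fin n → ℤ}
    (hvu : T'.IsRootWithRay v u) {a : P.Point → ℂ} (ha : a ∈ U) : rootOperator v u f a = 0 := by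
  have hvP : latt v ∈ P.carrier := by
    simpa using add_mem_of_isRootWithRay hvu P.origin (by simp)
  have hd : (-v, -1) ∈ negDegrees P := neg_point_mem_negDegrees ⟨v, hvP⟩
  have heuler := hh.euler _ hd u 1 a ha
  simp only [neg_dotProduct, hvu.2.1, neg_neg, one_mul, add_neg_cancel, Int.cast_zero,
    zero_mul] at heuler
  rw [← heuler]
  refine Finset.sum_congr rfl fun v' _ => ?_
  by_cases hv' : v'.1 ⬝ᵥ u = -1
  · simp [hv']
  let w₀ : P.Point := ⟨v'.1 + v, add_mem_of_isRootWithRay hvu v' hv'⟩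
  have hdeg : ((0, -1) - (w₀.1, 1) : (Fin n → ℤ) × ℤ) = (-v, -1) - (v'.1, 1) :=
    Prod.ext (by change 0 - (v'.1 + v) = -v - v'.1; abel) rfl
  have hpartial : partialD w₀ f a = partialD v' (h (-v, -1)) a := by
    rw [partialD_congr hh.isOpen hf w₀ ha, hh.partialD_eq _ zero_neg_one_mem_negDegrees w₀ ha,
      hh.partialD_eq _ hd v' ha, hdeg]
  rw [Finset.sum_eq_single w₀ (fun w _ hw => if_neg fun h => hw (Subtype.ext h.2)) (by simp),
    if_pos ⟨hv', rfl⟩, hpartial]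

theorem isExtendedGKZSolution (hh : IsGKZFamily U h) (hf : Set.EqOn f (h (0, -1)) U)
    (T' : RegularProjectiveTriangulation (polarDual P.carrier)) :
    IsExtendedGKZSolution T' U f :=
  { hh.isGKZSolution hf with root := fun _ _ hvu _ ha => hh.rootOperator_eq_zero hf hvu ha }

end IsGKZFamily

end Family

/-! ### The cohomology-valued gamma series -/

section Solution

variable {n : ℕ} {P : ReflexivePolytope n} {T : RegularProjectiveTriangulation P.carrier}

instance : IsModuleTopology ℂ (CohomologyRing T) := ⟨rfl⟩

theorem sum_weight_mul_divisor (u : Fin n → ℤ) (k : ℤ) :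
    ∑ v : P.Point, ((v.1 ⬝ᵥ u + k : ℤ) : CohomologyRing T) * divisor T v = 0 := by
  rw [← sum_dotProduct_add_smul_divisor (T := T) (latt u) k]
  refine Finset.sum_congr rfl fun v _ => ?_
  rw [latt_dotProduct, dotProduct_comm u, ← Int.cast_add, Complex.ofReal_intCast,
    Algebra.smul_def, map_intCast]

theorem sum_weight_mul_exponent (u : Fin n → ℤ) (k : ℤ) (p : P.Point → ℤ) :
    ∑ v : P.Point, (v.1 ⬝ᵥ u + k) * p v = (expDegree P p).1 ⬝ᵥ u + k * (expDegree P p).2 := by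
  change _ = (∑ v, p v • v.1) ⬝ᵥ u + k * ∑ v, p v
  rw [sum_dotProduct, Finset.mul_sum, ← Finset.sum_add_distrib]
  refine Finset.sum_congr rfl fun v _ => ?_
  rw [smul_dotProduct, smul_eq_mul]
  ring

variable {A : Type*} [NormedCommRing A] [NormedAlgebra ℂ A] (φ : CohomologyRing T ≃ₐ[ℂ] A)

theorem map_gammaCoeff_divisor (p : P.Point → ℤ) :
    φ (gammaCoeff (divisor T) p) = gammaCoeff (fun v => φ (divisor T v)) p :=
  map_gammaCoeff (φ : CohomologyRing T ≃+* A) _ _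

/-- The coefficients of the sum over `M` in `B`, as a family indexed by all exponents. -/
def moriCoeff : (P.Point → ℤ) → A := (moriPoints T).indicator fun ℓ => φ (coeffO T ℓ)

theorem moriCoeff_of_mem {ℓ : P.Point → ℤ} (hℓ : ℓ ∈ moriPoints T) :
    moriCoeff φ ℓ = φ (coeffO T ℓ) :=
  Set.indicator_of_mem hℓ _

theorem mem_moriPoints_of_moriCoeff_ne_zero {ℓ : P.Point → ℤ} (hℓ : moriCoeff φ ℓ ≠ 0) :
    ℓ ∈ moriPoints T :=
  Set.mem_of_indicator_ne_zero hℓ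

theorem add_mem_moriPoints_of_gammaCoeffOfDegree_ne_zero {d : (Fin n → ℤ) × ℤ}
    {p m : P.Point → ℤ} (hm : 0 ≤ m) (hmd : expDegree P m = -d)
    (hp : gammaCoeffOfDegree (fun v => φ (divisor T v)) (expDegree P) d p ≠ 0) :
    p + m ∈ moriPoints T := by
  have hpd := eq_of_gammaCoeffOfDegree_ne_zero hp
  rw [gammaCoeffOfDegree_of_eq hpd, ← map_gammaCoeff_divisor] at hp
  refine add_mem_moriPoints_of_gammaCoeff_ne_zero hm (fun h => hp (by rw [h, map_zero])) ?_
  rw [mem_relations_iff, map_add, hpd, hmd, add_neg_cancel]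

theorem gammaCoeffOfDegree_sub_single_origin (ℓ : P.Point → ℤ) :
    gammaCoeffOfDegree (fun v => φ (divisor T v)) (expDegree P) (0, -1)
      (ℓ - Pi.single P.origin 1) = moriCoeff φ ℓ * φ (divisor T P.origin) := by
  by_cases hℓ : ℓ ∈ moriPoints T
  · have hdeg : expDegree P (ℓ - Pi.single P.origin 1) = (0, -1) := by
      simp [mem_relations_iff.1 hℓ.1, expDegree_single]
    rw [gammaCoeffOfDegree_of_eq hdeg, moriCoeff_of_mem φ hℓ, ← map_mul,
      coeffO_mul_divisor_origin (moriPoints_origin_nonpos hℓ), map_gammaCoeff_divisor]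
  · rw [moriCoeff, Set.indicator_of_notMem hℓ, zero_mul]
    by_contra hne
    have hmem := add_mem_moriPoints_of_gammaCoeffOfDegree_ne_zero φ (m := Pi.single P.origin 1)
      (Pi.single_nonneg.2 zero_le_one) (by simp [expDegree_single]) hne
    exact hℓ (by rwa [sub_add_cancel] at hmem)

theorem map_coeffO {ℓ : P.Point → ℤ} (hℓ : ℓ ∈ moriPoints T) : φ (coeffO T ℓ) =
    gammaCoeff (fun v => φ ((divisor T - Pi.single P.origin 1 : P.Point → _) v)) ℓ := by
  rw [coeffO_eq_gammaCoeff (moriPoints_origin_nonpos hℓ)]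
  exact map_gammaCoeff (φ : CohomologyRing T ≃+* A) _ _

section Topology

variable [FiniteDimensional ℂ A]

/-- An algebra isomorphism of the cohomology ring with a normed algebra, as a homeomorphism. -/
def cohomologyEquiv : CohomologyRing T ≃L[ℂ] A :=
  haveI : IsModuleTopology ℂ A := isModuleTopologyOfFiniteDimensional
  haveI : ContinuousAdd (CohomologyRing T) := IsModuleTopology.toContinuousAdd ℂ _
  haveI : ContinuousSMul ℂ (CohomologyRing T) := IsModuleTopology.toContinuousSMul ℂ _
  { φ.toLinearEquiv with
    continuous_toFun := IsModuleTopology.continuous_of_linearMap φ.toLinearEquiv.toLinearMap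
    continuous_invFun :=
      IsModuleTopology.continuous_of_linearMap φ.toLinearEquiv.symm.toLinearMap }

theorem cohomologyEquiv_smul (c : ℂ) (x : CohomologyRing T) :
    cohomologyEquiv φ (c • x) = c • φ x :=
  map_smul φ c x

theorem cohomologyEquiv_monomial_smul (a : P.Point → ℂ) (ℓ : moriPoints T) :
    cohomologyEquiv φ (monomial a ℓ.1 • coeffO T ℓ.1) = laurent a ℓ.1 • moriCoeff φ ℓ.1 := by
  rw [cohomologyEquiv_smul, moriCoeff_of_mem φ ℓ.2]
  rfl

theorem map_tsum_coeffO (a : P.Point → ℂ) :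
    φ (∑' ℓ : moriPoints T, monomial a ℓ.1 • coeffO T ℓ.1) = laurentSeries (moriCoeff φ) a := by
  have : T2Space (CohomologyRing T) := (cohomologyEquiv φ).toHomeomorph.symm.t2Space
  have hsupport : (Function.support fun ℓ => laurent a ℓ • moriCoeff φ ℓ) ⊆ moriPoints T :=
    fun ℓ hℓ => mem_moriPoints_of_moriCoeff_ne_zero φ (right_ne_zero_of_smul hℓ)
  rw [laurentSeries, ← tsum_subtype_eq_of_support_subset hsupport]
  exact ((cohomologyEquiv φ).map_tsum).trans (tsum_congr (cohomologyEquiv_monomial_smul φ a))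

end Topology

section Convergence

variable [CompleteSpace A] {κ : Type*} [Fintype κ] {g : κ → P.Point → ℤ}

theorem exists_isWordDominated (hg : IsMoriGenerators T g) :
    ∃ ε : ℝ, 0 < ε ∧ ε < 1 ∧ IsWordDominated g ε (moriCoeff φ) ∧
      ∀ d ∈ negDegrees P, IsWordDominated g ε
        (gammaCoeffOfDegree (fun v => φ (divisor T v)) (expDegree P) d) := by
  obtain ⟨C₁, hC₁, h₁⟩ := exists_norm_gammaCoeff_le fun v => φ (divisor T v)
  obtain ⟨C₂, hC₂, h₂⟩ := exists_norm_gammaCoeff_le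
    fun v => φ ((divisor T - Pi.single P.origin 1 : P.Point → _) v)
  set C := max C₁ C₂
  have hC : 1 ≤ C := hC₁.trans (le_max_left _ _)
  have hmono : ∀ {C' : ℝ}, 1 ≤ C' → C' ≤ C → ∀ (K : ℝ) (N : ℕ), K * C' ^ N ≤ |K| * C ^ N :=
    fun h1 hle K N => by
      gcongr
      exact le_abs_self K
  set s := Fintype.card κ * C ^ (∑ k, ∑ i, (g k i).natAbs)
  have hs : 0 ≤ s := by positivity
  have hlt : Fintype.card κ * (C ^ (∑ k, ∑ i, (g k i).natAbs) * (s + 2)⁻¹) < 1 := by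
    rw [← mul_assoc, mul_inv_lt_iff₀ (by linarith)]
    linarith
  refine ⟨(s + 2)⁻¹, by positivity, inv_lt_one_of_one_lt₀ (by linarith), ?_, fun d hd => ?_⟩
  · obtain ⟨K, hK⟩ := h₂ 0
    refine isWordDominated_of_norm_le (m := 0) (K := |K|) hC hlt (fun ℓ hℓ => ?_) fun ℓ hℓ => ?_
    all_goals have hmem : ℓ ∈ moriPoints T := mem_moriPoints_of_moriCoeff_ne_zero φ hℓ
    · simpa using hg.exists_wordSum ℓ hmem
    · rw [moriCoeff_of_mem φ hmem, map_coeffO φ hmem]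
      exact (hK ℓ hmem.1.2).trans (hmono hC₂ (le_max_right _ _) _ _)
  · obtain ⟨m, hm, hmd⟩ := hd
    obtain ⟨K, hK⟩ := h₁ d.2
    refine isWordDominated_of_norm_le (m := m) (K := |K|) hC hlt (fun p hp => ?_) fun p hp => ?_
    · exact hg.exists_wordSum _ (add_mem_moriPoints_of_gammaCoeffOfDegree_ne_zero φ hm hmd hp)
    · have hpd := eq_of_gammaCoeffOfDegree_ne_zero hp
      rw [gammaCoeffOfDegree_of_eq hpd]
      exact (hK p (congrArg Prod.snd hpd)).trans (hmono hC₁ (le_max_left _ _) _ _)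

variable {ε : ℝ} {a : P.Point → ℂ}

theorem laurentSeries_gammaCoeffOfDegree (h : IsWordDominated g ε (moriCoeff φ)) (hε : 0 ≤ ε)
    (ha : a ∈ smallRegion g ε) :
    laurentSeries (gammaCoeffOfDegree (fun v => φ (divisor T v)) (expDegree P) (0, -1)) a =
      (a P.origin)⁻¹ • (laurentSeries (moriCoeff φ) a * φ (divisor T P.origin)) := by
  have hsum := ((h.summable hε ha).hasSum.mul_right (φ (divisor T P.origin))).const_smul
    (a P.origin)⁻¹
  refine HasSum.tsum_eq ((Equiv.subRight (Pi.single P.origin (1 : ℤ))).hasSum_iff.1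
    (hsum.congr_fun fun ℓ => ?_))
  rw [Function.comp_apply, Equiv.subRight_apply, gammaCoeffOfDegree_sub_single_origin,
    laurent_sub_single ha.1, smul_mul_assoc, smul_smul, mul_comm]

variable [FiniteDimensional ℂ A]

theorem summable_coeffO (h : IsWordDominated g ε (moriCoeff φ)) (hε : 0 ≤ ε)
    (ha : a ∈ smallRegion g ε) :
    Summable fun ℓ : moriPoints T => monomial a ℓ.1 • coeffO T ℓ.1 := by
  rw [← (cohomologyEquiv φ).summable]
  exact ((h.summable hε ha).subtype (moriPoints T)).congr fun ℓ =>
    (cohomologyEquiv_monomial_smul φ a ℓ).symm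

theorem isNilpotent_sum_smul_divisor (c : P.Point → ℂ) :
    IsNilpotent (∑ v, c v • divisor T v) :=
  isNilpotent_sum fun v _ => (isNilpotent_divisor v).smul (c v)

theorem map_seriesB_mul (h : IsWordDominated g ε (moriCoeff φ)) (hε : 0 ≤ ε)
    (ha : a ∈ smallRegion g ε) (lg : (P.Point → ℂ) → (P.Point → ℂ)) :
    φ (seriesB T lg a * -divisor T P.origin) =
      -gammaSeries (fun v => φ (divisor T v)) lg (expDegree P) (0, -1) a := by
  have hexp : φ (IsNilpotent.exp (∑ v, lg a v • divisor T v)) =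
      expFactor lg (fun v => φ (divisor T v)) a := by
    rw [expFactor]
    simpa using map_isNilpotentExp (φ : CohomologyRing T →ₐ[ℂ] A)
      (isNilpotent_sum_smul_divisor (lg a))
  rw [gammaSeries, laurentSeries_gammaCoeffOfDegree φ h hε ha, seriesB, mul_neg, map_neg, map_mul,
    map_smul, map_mul, map_tsum_coeffO, hexp, smul_mul_assoc, smul_mul_assoc, mul_right_comm]

end Convergence

section GKZ

theorem partialD_clm_comp {E : Type*} [NormedAddCommGroup E] [NormedSpace ℂ E] (β : E →L[ℂ] ℂ)
    {F : (P.Point → ℂ) → E} {a : P.Point → ℂ} (hF : DifferentiableAt ℂ F a) (v : P.Point) :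
    partialD v (fun b => β (F b)) a = β (lineDeriv ℂ F a (Pi.single v 1)) := by
  rw [(hF.hasFDerivAt.hasLineDerivAt _).lineDeriv]
  exact ((β.hasFDerivAt.comp a hF.hasFDerivAt).hasLineDerivAt _).lineDeriv

variable [CompleteSpace A] {κ : Type*} [Fintype κ] {g : κ → P.Point → ℤ} {ε : ℝ}
  {U : Set (P.Point → ℂ)} {lg : (P.Point → ℂ) → (P.Point → ℂ)}

theorem isGKZFamily_gammaSeries (β : A →L[ℂ] ℂ) (hdom : ∀ d ∈ negDegrees P, IsWordDominated g ε
      (gammaCoeffOfDegree (fun v => φ (divisor T v)) (expDegree P) d))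
    (hε : 0 < ε) (hlg : IsLogBranch U lg) (hU : U ⊆ smallRegion g ε) :
    IsGKZFamily U fun d a =>
      β (gammaSeries (fun v => φ (divisor T v)) lg (expDegree P) d a) := by
  classical
  have han := fun d hd => analyticOnNhd_gammaSeries (hdom d hd) hε hlg hU
  have hpartial := fun d hd v a ha =>
    partialD_clm_comp β (han d hd a ha).differentiableAt v
  have hweight : ∀ (u : Fin n → ℤ) (k : ℤ),
      ∑ v : P.Point, ((v.1 ⬝ᵥ u + k : ℤ) : A) * φ (divisor T v) = 0 := fun u k => by
    simpa only [map_sum, map_mul, map_intCast, map_zero] using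
      congrArg φ (sum_weight_mul_divisor (T := T) u k)
  refine ⟨hlg.isOpen, fun d hd => β.comp_analyticOnNhd (han d hd), fun d hd v a ha => ?_,
    fun d hd u k a ha => ?_⟩
  · have hd' := hdom _ (sub_expDegree_mem_negDegrees hd (m := Pi.single v 1)
      (Pi.single_nonneg.2 zero_le_one))
    rw [hpartial d hd v a ha, lineDeriv_gammaSeries (fun v => (isNilpotent_divisor v).map φ)
      (hdom d hd) hd' hε hlg hU ha, expDegree_single]
  · have hsum := congrArg β (sum_mul_lineDeriv_gammaSeries (hdom d hd) hε hlg hU ha (hweight u k)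
      fun p hp => by rw [sum_weight_mul_exponent, hp])
    simpa only [map_sum, map_smul, smul_eq_mul, hpartial d hd _ a ha] using hsum

end GKZ

end Solution

end ToricGKZ
end

open ToricGKZ in
theorem mainTheorem2 {n : ℕ} (P : ReflexivePolytope n)
    (T : RegularProjectiveTriangulation P.carrier)
    (T' : RegularProjectiveTriangulation (polarDual P.carrier)) :
    ∃ ε : ℝ, 0 < ε ∧ ε < 1 ∧ IsOpen (nearLCSL T ε) ∧ (nearLCSL T ε).Nonempty ∧
      (∀ a ∈ nearLCSL T ε, Summable fun ℓ : moriPoints T => monomial a ℓ.1 • coeffO T ℓ.1) ∧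
      ∀ U : Set (P.Point → ℂ), IsOpen U → U ⊆ nearLCSL T ε →
        ∀ lg : (P.Point → ℂ) → (P.Point → ℂ), ContinuousOn lg U →
          (∀ a ∈ U, ∀ v, Complex.exp (lg a v) = a v) →
          ∀ α : CohomologyRing T →ₗ[ℂ] ℂ,
            (∀ v u, T'.IsRootWithRay v u → ∀ a ∈ U,
              rootOperator v u (fun b => α (seriesB T lg b * -divisor T P.origin)) a = 0) ∧
            IsExtendedGKZSolution T' U
              (fun b => α (seriesB T lg b * -divisor T P.origin)) := by
  have := finite_cohomologyRing T
  obtain ⟨A, _, _, _, ⟨φ⟩⟩ := exists_normedCommRing_algEquiv (CohomologyRing T)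
  have : CompleteSpace A := FiniteDimensional.complete ℂ A
  obtain ⟨κ, _, g, hg⟩ := exists_isMoriGenerators T
  obtain ⟨ε, hε, hε1, hmori, hgamma⟩ := exists_isWordDominated φ hg
  obtain ⟨ω, hω⟩ := hg.exists_pos
  have hregion : nearLCSL T ε = smallRegion g ε := hg.nearLCSL_eq hε1.le
  refine ⟨ε, hε, hε1, ?_⟩
  rw [hregion]
  refine ⟨isOpen_smallRegion g ε, smallRegion_nonempty hω hε,
    fun a ha => summable_coeffO φ hmori hε.le ha, fun U hU hUε lg hlg hexp α => ?_⟩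
  let β : A →L[ℂ] ℂ := LinearMap.toContinuousLinearMap (-(α ∘ₗ φ.symm.toLinearMap))
  have hfamily := isGKZFamily_gammaSeries φ β hgamma hε ⟨hU, hlg, hexp⟩ hUε
  have hf : Set.EqOn (fun b => α (seriesB T lg b * -divisor T P.origin))
      (fun a => β (gammaSeries (fun v => φ (divisor T v)) lg (expDegree P) (0, -1) a)) U := by
    intro a ha
    change _ = -α (φ.symm _)
    rw [← map_neg, ← map_neg, ← map_seriesB_mul φ hmori hε.le (hUε ha), φ.symm_apply_apply]
  have hsolution := hfamily.isExtendedGKZSolution hf T'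
  exact ⟨hsolution.root, hsolution⟩
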